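/- Let $k$ be a field, $n\ge 0$ an integer, and let $f\in k[x_1,\dots,x_n]\setminus k$. Then the following conditions are equivalent: (i) $f$ is non-composite, i.e. whenever $f=F(g)$ with $F\in k[t]$ and $g\in k[x_1,\dots,x_n]$, one has $\deg F=1$; (ii) $k[f]$ is a maximal element, with respect to inclusion, of the set of all subalgebras $k[h]$ with $h\in k[x_1,\dots,x_n]\setminus k$; (iii) $f$ is closed, i.e. the subalgebra $k[f]$ is integrally closed in $k[x_1,\dots,x_n]$. If $k$ is perfect and $\overline{k}$ denotes an algebraic closure of $k$, then (i)–(iii) are also equivalent to each of the following: (iv) $f+\lambda$ is irreducible in $\overline{k}[x_1,\dots,x_n]$ for all but finitely many $\lambda\in\overline{k}$; (v) there exists $\lambda\in\overline{k}$ such that $f+\lambda$ is irreducible in $\overline{k}[x_1,\dots,x_n]$. If $k$ has characteristic $0$, then (i)–(v) are also equivalent to each of the following: (vi) there exists a finite family $\{D_i\}$ of $k$-derivations of $k[x_1,\dots,x_n]$ such that $k[f]=\bigcap_i\operatorname{Ker}D_i$; (vi') there exists a family $\{D_i\}$, not necessarily finite, of $k$-derivations of $k[x_1,\dots,x_n]$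 such that $k[f]=\bigcap_i\operatorname{Ker}D_i$. -/

import Mathlib

open MvPolynomial

namespace ClosedPoly

variable {k : Type*} [Field k] {n : ℕ}

/-- `f` does not lie in the field `k` of constants. -/
def IsNonconstant (f : MvPolynomial (Fin n) k) : Prop :=
  f ∉ Set.range (C : k → MvPolynomial (Fin n) k)

/-- A nonconstant polynomial `f` is non-composite if `f = F(g)`, with `F` a polynomial in one
variable and `g` a polynomial in `n` variables, implies `deg F = 1`. -/
def IsNonComposite (f : MvPolynomial (Fin n) k) : Prop :=
  IsNonconstant f ∧
    ∀ (F : Polynomial k) (g : MvPolynomial (Fin n) k), f = Polynomial.aeval g F → F.degree = 1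

/-- The set of all subalgebras `k[f]` with `f` nonconstant (ordered by inclusion). -/
def singlyGenerated (k : Type*) [Field k] (n : ℕ) : Set (Subalgebra k (MvPolynomial (Fin n) k)) :=
  {A | ∃ f : MvPolynomial (Fin n) k, IsNonconstant f ∧ A = Algebra.adjoin k {f}}

/-- A nonconstant polynomial `f` is closed if `k[f]` is integrally closed in `k[x₁, …, xₙ]`. -/
def IsClosedPoly (f : MvPolynomial (Fin n) k) : Prop :=
  IsNonconstant f ∧
    IsIntegrallyClosedIn (Algebra.adjoin k {f}) (MvPolynomial (Fin n) k)

/-- `f + μ` is irreducible over the algebraic closure of `k`, for `μ` in that closure. -/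
def IrreducibleShift (f : MvPolynomial (Fin n) k) (μ : AlgebraicClosure k) : Prop :=
  Irreducible (map (algebraMap k (AlgebraicClosure k)) f + C μ)

/-- `k[f]` is the intersection of the kernels of the `k`-derivations in the family `S`. -/
def IsKernelIntersection (f : MvPolynomial (Fin n) k)
    (S : Set (Derivation k (MvPolynomial (Fin n) k) (MvPolynomial (Fin n) k))) : Prop :=
  (Algebra.adjoin k {f} : Set (MvPolynomial (Fin n) k)) = ⋂ D ∈ S, {g | D g = 0}

end ClosedPoly

/-! Conditions (i) and (iii) are linked by a polynomial form of Lüroth's theorem,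
`exists_adjoin_eq_top`. A Kronecker substitution embeds the integral closure of `k[f]` into `k[X]`,
so this closure is some `k[h]`; then `f = F(h)`, and non-compositeness forces `deg F = 1`.
Conversely, `g` is integral over `k[F(g)]` for nonconstant `F`. Maximality is compared with
non-compositeness by degrees.

If `deg F ≥ 2`, then `F + μ` is reducible over the algebraic closure, and so is `F(g) + μ`; thus one
irreducible fibre already gives (i). In the other direction, `IsNonComposite.irreducible_generic`
treats the generic fibre `f - T`. With `T` identified with `f`, the point `(x₁, …, xₙ)` is a zero of
`f - T`, and a simple one, since some partial derivative of `f` is nonzero over a perfect field.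
Hence just one irreducible factor passes through it, and the automorphisms over `k(x₁, …, xₙ)` fix
that factor. As `k(f)` is algebraically closed in `k(x₁, …, xₙ)`, a Frobenius twist of the
factorization is defined over `k(T)`, where the twisted polynomial is irreducible. Splittings of
fibres are then points of a finite type algebra over `k[T]`; a point over infinitely many values of
`T` would give a splitting of the generic fibre.

In characteristic zero, a derivation vanishing on `k[f]` vanishes on everything integral over it, so
kernel intersections are closed. Conversely, an element outside a closed `k[f]` is transcendental
over `k(f)`, so its differential relative to `k(f)` is nonzero; this yields a derivation killing `f`
but not that element, and the Jacobian derivations of `f` detect it too. -/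

namespace ClosedPoly

/-! ### Normal subalgebras of `k[X]`: a polynomial Lüroth theorem. -/

section UnivariateSubalgebra

open Polynomial Polynomial.Bivariate

/-- The coefficients of `swap p`. -/
theorem coeff_coeff_swap {R : Type*} [CommSemiring R] (p : R[X][X]) (i j : ℕ) :
    ((swap p).coeff i).coeff j = (p.coeff j).coeff i := by
  induction p using Polynomial.induction_on' with
  | add p q hp hq => simp [map_add, hp, hq]
  | monomial n a =>
    induction a using Polynomial.induction_on' with
    | add p q hp hq => simp [map_add, hp, hq]
    | monomial m r =>
      rw [swap_monomial_monomial]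
      simp only [Polynomial.coeff_monomial]
      split_ifs <;> simp_all [Polynomial.coeff_monomial]

variable {k A : Type*} [Field k] [CommRing A] [Algebra k A]

/-- If `h(T) - h` is up to a constant the minimal polynomial of the variable over `A`,
then `h` generates `A`. -/
theorem adjoin_eq_top_of_dvd (ψ : A →ₐ[k] k[X]) (h : A) (hd : 0 < (ψ h).natDegree)
    (H : ∀ a : A, (ψ h).map (algebraMap k A) - Polynomial.C h ∣ (ψ a).map (algebraMap k A) - Polynomial.C a) :
    Algebra.adjoin k {h} = ⊤ := by
  have : Nontrivial A := ψ.toRingHom.domain_nontrivial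
  have hne : ψ h ≠ 0 := fun h0 => by simp [h0] at hd
  set B := Algebra.adjoin k {h} with hB
  have hhB : h ∈ B := Algebra.self_mem_adjoin_singleton k h
  have hinjB : Function.Injective (algebraMap k B) := (algebraMap k B).injective
  set p := Polynomial.C (ψ h).leadingCoeff⁻¹ * ψ h with hp
  have hpm : p.Monic := by
    rw [hp, mul_comm]; exact monic_mul_leadingCoeff_inv hne
  have hpd : p.natDegree = (ψ h).natDegree :=
    natDegree_C_mul (inv_ne_zero (leadingCoeff_ne_zero.2 hne))
  set c : k := (ψ h).leadingCoeff⁻¹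
  set r : Polynomial B := p.map (algebraMap k B) - Polynomial.C (algebraMap k B c * ⟨h, hhB⟩) with hr
  have hrm : r.Monic := by
    apply (hpm.map _).sub_of_left
    rw [degree_map_eq_of_injective hinjB]
    refine degree_C_le.trans_lt ?_
    rw [← natDegree_pos_iff_degree_pos, hpd]; exact hd
  have hrA : r.map (algebraMap B A) = Polynomial.C (algebraMap k A c) *
      ((ψ h).map (algebraMap k A) - Polynomial.C h) := by
    rw [hr, Polynomial.map_sub, Polynomial.map_map, ← IsScalarTower.algebraMap_eq, hp,
      Polynomial.map_mul, mul_sub, Polynomial.map_C, Polynomial.map_C, ← Polynomial.C_mul, map_mul,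
      ← IsScalarTower.algebraMap_apply]
    rfl
  rw [eq_top_iff]
  intro a _
  have hdv : r.map (algebraMap B A) ∣ (ψ a).map (algebraMap k A) - Polynomial.C a := by
    rw [hrA]
    have hu : IsUnit (Polynomial.C (algebraMap k A c)) := by
      apply IsUnit.map
      apply IsUnit.map
      exact isUnit_iff_ne_zero.2 (inv_ne_zero (leadingCoeff_ne_zero.2 hne))
    exact (hu.mul_left_dvd).2 (H a)
  have hrAm : (r.map (algebraMap B A)).Monic := hrm.map _
  have e1 : (ψ a).map (algebraMap k A) %ₘ r.map (algebraMap B A) = Polynomial.C a := by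
    have h0 := (modByMonic_eq_zero_iff_dvd hrAm).2 hdv
    rw [sub_modByMonic, sub_eq_zero] at h0
    rw [h0, modByMonic_eq_self_iff hrAm]
    refine degree_C_le.trans_lt ?_
    rw [← natDegree_pos_iff_degree_pos, hrm.natDegree_map, hr, natDegree_sub_C,
      natDegree_map_eq_of_injective hinjB, hpd]
    exact hd
  -- Division by a monic polynomial commutes with base change, and both dividend and divisor have
  -- coefficients in `k[h]`. Hence so does the remainder, which is the constant `a`.
  have e2 : ((ψ a).map (algebraMap k B) %ₘ r).map (algebraMap B A) = Polynomial.C a := by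
    rw [map_modByMonic _ hrm, Polynomial.map_map, ← IsScalarTower.algebraMap_eq, e1]
  have e3 := congrArg (fun q => q.coeff 0) e2
  simp only [Polynomial.coeff_map, coeff_C_zero] at e3
  rw [← e3]
  exact Subtype.property _

/-- A normal domain which embeds into `k[X]`, and not into the constants, is generated by one
element. -/
theorem exists_adjoin_eq_top [IsDomain A] [IsIntegrallyClosed A]
    (ψ : A →ₐ[k] k[X]) (hψ : Function.Injective ψ) (f : A) (hf : 0 < (ψ f).natDegree) :
    ∃ h : A, Algebra.adjoin k {h} = ⊤ := by
  let : Algebra A k[X] := ψ.toRingHom.toAlgebra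
  have hmap : ∀ a, algebraMap A k[X] a = ψ a := fun _ => rfl
  have : IsScalarTower k A k[X] := .of_algebraMap_eq fun x => (ψ.commutes x).symm
  have : FaithfulSMul A k[X] := (faithfulSMul_iff_algebraMap_injective A k[X]).2 hψ
  have haev : ∀ a : A, aeval (Polynomial.X : k[X]) ((ψ a).map (algebraMap k A) - Polynomial.C a) = 0 := by
    intro a
    rw [map_sub, Polynomial.aeval_map_algebraMap, Polynomial.aeval_X_left_apply, Polynomial.aeval_C, hmap, sub_self]
  have hint : IsIntegral A (Polynomial.X : k[X]) := by
    have hne : ψ f ≠ 0 := fun h0 => by simp [h0] at hf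
    refine ⟨Polynomial.C (algebraMap k A (ψ f).leadingCoeff⁻¹) * ((ψ f).map (algebraMap k A) - Polynomial.C f), ?_, ?_⟩
    · rw [mul_sub, ← Polynomial.C_mul, ← Polynomial.map_C, ← Polynomial.map_mul]
      have hm : (Polynomial.C (ψ f).leadingCoeff⁻¹ * ψ f).Monic := by
        rw [mul_comm]; exact monic_mul_leadingCoeff_inv hne
      apply (hm.map _).sub_of_left
      rw [degree_map_eq_of_injective (algebraMap k A).injective]
      refine degree_C_le.trans_lt ?_
      rw [← natDegree_pos_iff_degree_pos,
        natDegree_C_mul (inv_ne_zero (leadingCoeff_ne_zero.2 hne))]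
      exact hf
    · rw [← Polynomial.aeval_def, map_mul, haev, mul_zero]
  set P := minpoly A (Polynomial.X : k[X]) with hP
  have hPm : P.Monic := minpoly.monic hint
  have hdvd : ∀ a : A, P ∣ (ψ a).map (algebraMap k A) - Polynomial.C a := fun a =>
    minpoly.isIntegrallyClosed_dvd hint (haev a)
  -- If all coefficients of `P` were constants, substituting the variable `X` would return the same
  -- polynomial, so `P` would be zero.
  obtain ⟨i, hi⟩ : ∃ i, 0 < (ψ (P.coeff i)).natDegree := by
    by_contra! hcon
    have h0 : P.map ψ.toRingHom = ((P.map ψ.toRingHom).map Polynomial.constantCoeff).map Polynomial.C := by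
      ext1 i
      simp only [Polynomial.coeff_map]
      exact eq_C_of_natDegree_le_zero (hcon i)
    have h1 : (P.map ψ.toRingHom).eval Polynomial.X = 0 := by
      rw [Polynomial.eval_map]; exact minpoly.aeval A (Polynomial.X : k[X])
    rw [h0, Polynomial.eval_map, ← Polynomial.algebraMap_eq, ← Polynomial.aeval_def, Polynomial.aeval_X_left_apply] at h1
    rw [h1, Polynomial.map_zero] at h0
    exact (hPm.map ψ.toRingHom).ne_zero h0
  set h := P.coeff i with hh
  refine ⟨h, adjoin_eq_top_of_dvd ψ h hi fun a => ?_⟩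
  suffices hs : (ψ h).map (algebraMap k A) - Polynomial.C h ∣ P from hs.trans (hdvd a)
  obtain ⟨Q, hQ⟩ := hdvd h
  have hne : ψ h ≠ 0 := fun h0 => by simp [h0] at hi
  set d := (ψ h).natDegree with hd
  have hcomp : ψ.toRingHom.comp (algebraMap k A) = Polynomial.C := by
    ext x; simp
  -- After the swap, `natDegree` measures the degree in the variable of the coefficients. The left
  -- side has degree `d` there, and `P` already contributes at least `d` through its coefficient
  -- `h`. So `Q` contributes nothing, and comparing top coefficients makes it a constant of `k`.
  have key : Polynomial.C (ψ h) - (ψ h).map Polynomial.C = swap (P.map ψ.toRingHom) * swap (Q.map ψ.toRingHom) := by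
    rw [← map_mul, ← Polynomial.map_mul, ← hQ, Polynomial.map_sub, Polynomial.map_map, hcomp,
      map_sub, swap_map_C, Polynomial.map_C, swap_C]
    rfl
  have hle : (Polynomial.C (ψ h) - (ψ h).map Polynomial.C).natDegree ≤ d := by
    refine (natDegree_sub_le _ _).trans ?_
    simp [natDegree_map_eq_of_injective (Polynomial.C_injective)]
    rfl
  have hcoef : (Polynomial.C (ψ h) - (ψ h).map Polynomial.C).coeff d = Polynomial.C (-(ψ h).leadingCoeff) := by
    rw [Polynomial.coeff_sub, Polynomial.coeff_C_of_ne_zero hi.ne', Polynomial.coeff_map, zero_sub, map_neg]; rfl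
  have hKne : Polynomial.C (ψ h) - (ψ h).map Polynomial.C ≠ 0 := fun h0 => by
    rw [h0, Polynomial.coeff_zero, eq_comm, Polynomial.C_eq_zero, neg_eq_zero, leadingCoeff_eq_zero] at hcoef
    exact hne hcoef
  have hPd : d ≤ (swap (P.map ψ.toRingHom)).natDegree := by
    apply le_natDegree_of_ne_zero
    intro h0
    have := congrArg (fun q => q.coeff i) h0
    simp only [coeff_coeff_swap, Polynomial.coeff_map, Polynomial.coeff_zero] at this
    exact leadingCoeff_ne_zero.2 hne this
  have hPne : swap (P.map ψ.toRingHom) ≠ 0 := fun h0 => hKne (by rw [key, h0, zero_mul])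
  have hQne : swap (Q.map ψ.toRingHom) ≠ 0 := fun h0 => hKne (by rw [key, h0, mul_zero])
  have hdeg := natDegree_mul hPne hQne
  rw [← key] at hdeg
  have hQd : (swap (Q.map ψ.toRingHom)).natDegree = 0 := by omega
  obtain ⟨q, hq⟩ : ∃ q, swap (Q.map ψ.toRingHom) = Polynomial.C q := ⟨_, eq_C_of_natDegree_eq_zero hQd⟩
  have hqu : IsUnit q := by
    have h2 := congrArg (fun r => r.coeff d) key
    simp only [hq, coeff_mul_C, hcoef] at h2
    refine isUnit_of_mul_isUnit_right (x := (swap (P.map ψ.toRingHom)).coeff d) ?_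
    rw [← h2]
    exact (isUnit_iff_ne_zero.2 (neg_ne_zero.2 (leadingCoeff_ne_zero.2 hne))).map Polynomial.C
  obtain ⟨c, hcu, rfl⟩ := Polynomial.isUnit_iff.1 hqu
  have hQmap : Q.map ψ.toRingHom = (Polynomial.C (algebraMap k A c)).map ψ.toRingHom := by
    apply swap.injective
    rw [hq, Polynomial.map_C, swap_C]
    simp
  have hQeq : Q = Polynomial.C (algebraMap k A c) := Polynomial.map_injective _ hψ hQmap
  rw [hQ, hQeq]
  exact ((((hcu.map (algebraMap k A))).map Polynomial.C).mul_right_dvd).2 dvd_rfl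

end UnivariateSubalgebra

end ClosedPoly

namespace ClosedPoly

/-! ### Non-composite, maximal and closed are equivalent. -/

section Closed

open Algebra

variable {k : Type*} [Field k] {n : ℕ} {f g : MvPolynomial (Fin n) k}

theorem isNonconstant_iff : IsNonconstant f ↔ ∃ m, m ≠ 0 ∧ coeff m f ≠ 0 := by
  constructor
  · intro h
    by_contra! hc
    refine h ⟨coeff 0 f, ?_⟩
    ext m
    rw [coeff_C]
    split_ifs with h0
    · rw [h0]
    · exact (hc m (Ne.symm h0)).symm
  · rintro ⟨m, hm, hc⟩ ⟨a, rfl⟩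
    rw [coeff_C, if_neg hm.symm] at hc
    exact hc rfl

/-- A Kronecker substitution keeps a given polynomial nonconstant. -/
theorem IsNonconstant.exists_algHom (hf : IsNonconstant f) :
    ∃ ψ : MvPolynomial (Fin n) k →ₐ[k] Polynomial k, 0 < (ψ f).natDegree := by
  classical
  obtain ⟨m, hm, hc⟩ := isNonconstant_iff.1 hf
  -- All exponents in `f` are below `N`, so `e` reads them as base-`N` digits and is injective on
  -- the support: no two monomials of `f` merge under `x_i ↦ X ^ N ^ i`.
  set N := f.totalDegree + 1 with hN
  let e : (Fin n →₀ ℕ) → ℕ := fun s => ∑ i, s i * N ^ (i : ℕ)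
  have hlt : ∀ s ∈ f.support, ∀ i, s i < N := fun s hs i => by
    have h1 : s i ≤ s.degree := Finsupp.le_degree i s
    have h2 : s.degree ≤ f.totalDegree := by
      have := le_totalDegree hs
      rw [Finsupp.degree_apply]
      exact this
    omega
  have hinj : Set.InjOn e f.support := by
    intro s hs t ht hst
    let s' : Fin n → Fin N := fun i => ⟨s i, hlt s hs i⟩
    let t' : Fin n → Fin N := fun i => ⟨t i, hlt t ht i⟩
    have : finFunctionFinEquiv s' = finFunctionFinEquiv t' := by
      apply Fin.ext
      rw [finFunctionFinEquiv_apply, finFunctionFinEquiv_apply]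
      exact hst
    have h2 := finFunctionFinEquiv.injective this
    ext i
    simpa [s', t'] using congrArg (fun u => ((u i : Fin N) : ℕ)) h2
  let ψ : MvPolynomial (Fin n) k →ₐ[k] Polynomial k :=
    aeval fun i => (Polynomial.X : Polynomial k) ^ (N ^ (i : ℕ))
  refine ⟨ψ, ?_⟩
  have hψ : ψ f = ∑ s ∈ f.support, Polynomial.monomial (e s) (coeff s f) := by
    rw [aeval_def, eval₂_eq']
    refine Finset.sum_congr rfl fun s _ => ?_
    rw [← Polynomial.C_mul_X_pow_eq_monomial, ← Finset.prod_pow_eq_pow_sum]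
    congr 1
    refine Finset.prod_congr rfl fun i _ => ?_
    rw [← pow_mul, mul_comm]
  have hms : m ∈ f.support := mem_support_iff.2 hc
  have hcoef : (ψ f).coeff (e m) = coeff m f := by
    rw [hψ, Polynomial.finsetSum_coeff, Finset.sum_eq_single m]
    · rw [Polynomial.coeff_monomial, if_pos rfl]
    · intro s hs hsm
      rw [Polynomial.coeff_monomial, if_neg fun h => hsm (hinj hs hms h)]
    · exact fun h => absurd hms h
  refine lt_of_lt_of_le ?_ (Polynomial.le_natDegree_of_ne_zero (hcoef ▸ hc))
  obtain ⟨i, hi⟩ := Finsupp.ne_iff.1 hm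
  refine lt_of_lt_of_le ?_ (Finset.single_le_sum (f := fun i => m i * N ^ (i : ℕ))
    (fun i _ => Nat.zero_le _) (Finset.mem_univ i))
  have : m i ≠ 0 := hi
  positivity

theorem algHom_aeval (ψ : MvPolynomial (Fin n) k →ₐ[k] Polynomial k) (g : MvPolynomial (Fin n) k)
    (F : Polynomial k) : ψ (Polynomial.aeval g F) = F.comp (ψ g) := by
  rw [Polynomial.comp_eq_aeval, Polynomial.aeval_algHom_apply]

theorem IsNonconstant.aeval_injective (hf : IsNonconstant f) :
    Function.Injective (Polynomial.aeval f : Polynomial k →ₐ[k] MvPolynomial (Fin n) k) := by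
  obtain ⟨ψ, hψ⟩ := hf.exists_algHom
  refine (injective_iff_map_eq_zero _).2 fun F hF => ?_
  have h := algHom_aeval ψ f F
  rw [hF, map_zero] at h
  rcases Polynomial.comp_eq_zero_iff.1 h.symm with h | h
  · exact h
  · rw [h.2] at hψ
    simp at hψ

theorem IsNonconstant.of_aeval {F : Polynomial k} (hf : IsNonconstant (Polynomial.aeval g F)) :
    IsNonconstant g ∧ 0 < F.natDegree := by
  constructor
  · rintro ⟨a, rfl⟩
    refine hf ⟨F.eval a, ?_⟩
    have := Polynomial.aeval_algebraMap_apply (MvPolynomial (Fin n) k) a F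
    rw [MvPolynomial.algebraMap_eq] at this
    rw [this, Polynomial.coe_aeval_eq_eval]
  · by_contra! h
    rw [Polynomial.eq_C_of_natDegree_le_zero h] at hf
    exact hf ⟨F.coeff 0, by rw [Polynomial.aeval_C]; rfl⟩

theorem mem_adjoin_singleton_iff {R S : Type*} [CommRing R] [CommRing S] [Algebra R S] {x y : S} :
    y ∈ adjoin R {x} ↔ ∃ F : Polynomial R, y = Polynomial.aeval x F := by
  rw [adjoin_singleton_eq_range_aeval]
  exact ⟨fun ⟨F, hF⟩ => ⟨F, hF.symm⟩, fun ⟨F, hF⟩ => ⟨F, hF.symm⟩⟩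

theorem mem_adjoin_aeval_of_degree_eq_one {S : Type*} [CommRing S] [Algebra k S] {x : S}
    {F : Polynomial k} (hF : F.degree = 1) : x ∈ adjoin k {Polynomial.aeval x F} := by
  have ha : F.coeff 1 ≠ 0 := Polynomial.coeff_ne_zero_of_eq_degree hF
  rw [Polynomial.eq_X_add_C_of_degree_le_one hF.le]
  generalize F.coeff 0 = b
  generalize F.coeff 1 = a at ha
  refine mem_adjoin_singleton_iff.2
    ⟨Polynomial.C a⁻¹ * (Polynomial.X - Polynomial.C b), ?_⟩
  have h1 : algebraMap k S a⁻¹ * algebraMap k S a = 1 := by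
    rw [← map_mul, inv_mul_cancel₀ ha, map_one]
  simp only [map_mul, map_sub, map_add, Polynomial.aeval_C, Polynomial.aeval_X]
  linear_combination (-x) * h1

theorem adjoin_le_adjoin_iff {R S : Type*} [CommRing R] [CommRing S] [Algebra R S] {x y : S} :
    adjoin R {x} ≤ adjoin R {y} ↔ ∃ F : Polynomial R, x = Polynomial.aeval y F := by
  rw [← mem_adjoin_singleton_iff, adjoin_le_iff, Set.singleton_subset_iff, SetLike.mem_coe]

theorem IsNonComposite.maximal (hf : IsNonComposite f) :
    Maximal (· ∈ singlyGenerated k n) (adjoin k {f}) := by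
  refine ⟨⟨f, hf.1, rfl⟩, ?_⟩
  rintro _ ⟨g, _, rfl⟩ hle
  obtain ⟨F, rfl⟩ := adjoin_le_adjoin_iff.1 hle
  exact adjoin_le (Set.singleton_subset_iff.2 (mem_adjoin_aeval_of_degree_eq_one (hf.2 F g rfl)))

theorem isNonComposite_of_maximal (hf : IsNonconstant f)
    (hm : Maximal (· ∈ singlyGenerated k n) (adjoin k {f})) : IsNonComposite f := by
  refine ⟨hf, ?_⟩
  rintro F g rfl
  obtain ⟨hg, hF⟩ := hf.of_aeval
  have h1 := hm.2 ⟨g, hg, rfl⟩ (adjoin_le_adjoin_iff.2 ⟨F, rfl⟩)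
  obtain ⟨G, hG⟩ := adjoin_le_adjoin_iff.1 h1
  have h2 : Polynomial.aeval g (Polynomial.X : Polynomial k) = Polynomial.aeval g (G.comp F) := by
    rw [Polynomial.aeval_X, Polynomial.aeval_comp, ← hG]
  have h3 := congrArg Polynomial.natDegree (hg.aeval_injective h2)
  rw [Polynomial.natDegree_X, Polynomial.natDegree_comp] at h3
  refine (Polynomial.degree_eq_iff_natDegree_eq_of_pos one_pos).2 ?_
  exact Nat.eq_one_of_mul_eq_one_left h3.symm

theorem IsClosedPoly.mem_adjoin (hf : IsClosedPoly f) (hg : IsIntegral (adjoin k {f}) g) :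
    g ∈ adjoin k {f} := by
  have := hf.2
  obtain ⟨y, rfl⟩ := (IsIntegrallyClosedIn.isIntegral_iff (R := adjoin k {f})).1 hg
  exact y.2

/-- The element `x` is a root of `F(T) - F(x)`, which becomes monic after division by the leading
coefficient of `F`. -/
theorem isIntegral_adjoin_aeval {S : Type*} [CommRing S] [Algebra k S] {x : S} {F : Polynomial k}
    (hF : 0 < F.natDegree) : IsIntegral (adjoin k {Polynomial.aeval x F}) x := by
  have hF0 : F ≠ 0 := fun h => by simp [h] at hF
  let B := adjoin k {Polynomial.aeval x F}
  let y : B := ⟨Polynomial.aeval x F, self_mem_adjoin_singleton _ _⟩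
  refine IsIntegral.tower_top (R := adjoin k {Polynomial.aeval x F}) ?_
  set c := F.leadingCoeff⁻¹
  have hm : (F * Polynomial.C c).Monic := Polynomial.monic_mul_leadingCoeff_inv hF0
  refine ⟨(F * Polynomial.C c).map (algebraMap k B) - Polynomial.C (algebraMap k B c * y), ?_, ?_⟩
  · by_cases hB : Subsingleton B
    · exact Subsingleton.elim _ _
    have : Nontrivial B := not_subsingleton_iff_nontrivial.1 hB
    apply (hm.map _).sub_of_left
    refine Polynomial.degree_C_le.trans_lt ?_
    rw [← Polynomial.natDegree_pos_iff_degree_pos, hm.natDegree_map,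
      Polynomial.natDegree_mul_C (inv_ne_zero (Polynomial.leadingCoeff_ne_zero.2 hF0))]
    exact hF
  · rw [← Polynomial.aeval_def, map_sub, Polynomial.aeval_map_algebraMap, map_mul,
      Polynomial.aeval_C, Polynomial.aeval_C, map_mul, ← IsScalarTower.algebraMap_apply]
    change Polynomial.aeval x F * algebraMap k S c - algebraMap k S c * Polynomial.aeval x F = 0
    ring

theorem IsClosedPoly.isNonComposite (hf : IsClosedPoly f) : IsNonComposite f := by
  refine isNonComposite_of_maximal hf.1 ⟨⟨f, hf.1, rfl⟩, ?_⟩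
  rintro _ ⟨g, _, rfl⟩ hle
  obtain ⟨F, rfl⟩ := adjoin_le_adjoin_iff.1 hle
  exact adjoin_le (Set.singleton_subset_iff.2
    (hf.mem_adjoin (isIntegral_adjoin_aeval hf.1.of_aeval.2)))

/-- If a normal domain `M` has a `k`-homomorphism to `k[X]` under which `f` stays nonconstant, then
the integral closure of `k[f]` in `M` is generated by one element. -/
theorem exists_generator_integralClosure {M R A : Type*} [CommRing M] [IsDomain M]
    [IsIntegrallyClosed M] [CommRing R] [CommRing A] [Algebra k M] [Algebra k R] [Algebra k A]
    [Algebra R M] [Algebra R A] [Algebra A M] [IsScalarTower k R A] [IsScalarTower k A M]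
    [IsScalarTower R A M] [IsScalarTower k R M] [IsIntegralClosure A R M]
    (ψ : M →ₐ[k] Polynomial k) (f : R)
    (hf : ∀ r : R, ∃ F : Polynomial k, r = Polynomial.aeval f F)
    (hψ : 0 < (ψ (algebraMap R M f)).natDegree) :
    ∃ h : M, IsIntegral R h ∧ ∀ x, IsIntegral R x → ∃ F : Polynomial k, x = Polynomial.aeval h F := by
  have hinj : Function.Injective (algebraMap A M) := IsIntegralClosure.algebraMap_injective A R M
  have : IsDomain A := hinj.isDomain (algebraMap A M)
  have : FaithfulSMul A M := (faithfulSMul_iff_algebraMap_injective A M).2 hinj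
  have : IsIntegrallyClosedIn A M := IsIntegrallyClosedIn.of_isIntegralClosure R
  have : IsIntegrallyClosed A := IsIntegrallyClosed.of_isIntegrallyClosed_of_isIntegrallyClosedIn A M
  have : Algebra.IsIntegral R A := IsIntegralClosure.isIntegral_algebra R M
  have hψf : ψ.comp (IsScalarTower.toAlgHom k A M) (algebraMap R A f) = ψ (algebraMap R M f) := by
    rw [IsScalarTower.algebraMap_apply R A M]
    rfl
  have hRn : Nontrivial R := by
    refine ⟨f, 0, fun h0 => ?_⟩
    rw [h0, map_zero, map_zero] at hψ
    simp at hψ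
  obtain ⟨h, hh⟩ := exists_adjoin_eq_top (ψ.comp (IsScalarTower.toAlgHom k A M)) (by
    -- In an integral extension of domains, an ideal with zero contraction is zero, so injectivity
    -- need only be tested on polynomials in `f`.
    have hker : RingHom.ker (ψ.comp (IsScalarTower.toAlgHom k A M)).toRingHom = ⊥ := by
      apply Ideal.eq_bot_of_comap_eq_bot (R := R)
      rw [eq_bot_iff]
      intro r h0
      obtain ⟨F, rfl⟩ := hf r
      have h1 : ψ.comp (IsScalarTower.toAlgHom k A M)
        (algebraMap R A (Polynomial.aeval f F)) = 0 := h0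
      rw [← Polynomial.aeval_algebraMap_apply, ← Polynomial.aeval_algHom_apply, hψf,
        ← Polynomial.comp_eq_aeval] at h1
      rcases Polynomial.comp_eq_zero_iff.1 h1 with h | h
      · simp [h]
      · rw [h.2] at hψ
        simp at hψ
    exact (RingHom.injective_iff_ker_eq_bot _).2 hker) (algebraMap R A f) (by rwa [hψf])
  refine ⟨algebraMap A M h, IsIntegralClosure.isIntegral_iff.2 ⟨h, rfl⟩, fun x hx => ?_⟩
  obtain ⟨a, rfl⟩ := (IsIntegralClosure.isIntegral_iff (A := A)).1 hx
  obtain ⟨F, rfl⟩ := mem_adjoin_singleton_iff.1 (hh ▸ mem_top : a ∈ adjoin k {h})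
  exact ⟨F, (Polynomial.aeval_algebraMap_apply M h F).symm⟩

theorem exists_generator_integralClosure_adjoin {M : Type*} [CommRing M] [IsDomain M]
    [IsIntegrallyClosed M] [Algebra k M] (ψ : M →ₐ[k] Polynomial k) {f : M}
    (hψ : 0 < (ψ f).natDegree) {R : Subalgebra k M} (hR : R = adjoin k {f}) :
    ∃ h : M, IsIntegral R h ∧ ∀ x, IsIntegral R x → ∃ F : Polynomial k, x = Polynomial.aeval h F := by
  have hfR : f ∈ R := hR ▸ self_mem_adjoin_singleton k f
  have h1 : ∀ r : R, ∃ F : Polynomial k, r = Polynomial.aeval (⟨f, hfR⟩ : R) F := by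
    rintro ⟨r, hr⟩
    obtain ⟨F, hF⟩ := mem_adjoin_singleton_iff.1 (hR ▸ hr)
    refine ⟨F, Subtype.ext ?_⟩
    rw [← Subalgebra.coe_val, ← Polynomial.aeval_algHom_apply]
    exact hF
  exact exists_generator_integralClosure (R := R) (A := integralClosure R M) ψ ⟨f, hfR⟩ h1 hψ

/-- A generator `h` of the integral closure satisfies `f = F(h)`; then `deg F = 1` puts `h` back
into `k[f]`. -/
theorem IsNonComposite.isIntegrallyClosedIn (hf : IsNonComposite f)
    {R : Subalgebra k (MvPolynomial (Fin n) k)} (hR : R = adjoin k {f}) :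
    IsIntegrallyClosedIn R (MvPolynomial (Fin n) k) := by
  have hfR : f ∈ R := hR ▸ self_mem_adjoin_singleton k f
  obtain ⟨ψ, hψ⟩ := hf.1.exists_algHom
  obtain ⟨h, hi, key⟩ := exists_generator_integralClosure_adjoin ψ hψ hR
  have hfi : IsIntegral R f := isIntegral_algebraMap (x := (⟨f, hfR⟩ : R))
  obtain ⟨F, hF⟩ := key f hfi
  have hhR : h ∈ R := by
    have := mem_adjoin_aeval_of_degree_eq_one (hf.2 F h hF) (x := h)
    rwa [← hF, ← hR] at this
  refine isIntegrallyClosedIn_iff.2 ⟨Subtype.val_injective, fun {x} hx => ?_⟩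
  obtain ⟨G, rfl⟩ := key x hx
  exact ⟨⟨_, (adjoin_le (Set.singleton_subset_iff.2 hhR) : adjoin k {_} ≤ R)
      (mem_adjoin_singleton_iff.2 ⟨G, rfl⟩)⟩, rfl⟩

theorem IsNonComposite.isClosedPoly (hf : IsNonComposite f) : IsClosedPoly f :=
  ⟨hf.1, hf.isIntegrallyClosedIn rfl⟩

theorem isNonComposite_iff_isClosedPoly : IsNonComposite f ↔ IsClosedPoly f :=
  ⟨IsNonComposite.isClosedPoly, IsClosedPoly.isNonComposite⟩

theorem isNonComposite_iff_maximal (hf : IsNonconstant f) :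
    IsNonComposite f ↔ Maximal (· ∈ singlyGenerated k n) (adjoin k {f}) :=
  ⟨IsNonComposite.maximal, isNonComposite_of_maximal hf⟩

end Closed

end ClosedPoly

namespace ClosedPoly

/-! ### Separability: nonvanishing partial derivatives. -/

section PthPowers

variable {k : Type*} [Field k] {n : ℕ} {f : MvPolynomial (Fin n) k}

theorem IsNonComposite.pow_ne (hf : IsNonComposite f) {q : ℕ} (hq : q ≠ 1)
    (g : MvPolynomial (Fin n) k) : g ^ q ≠ f := by
  rintro rfl
  have h := hf.2 (Polynomial.X ^ q) g (by simp)
  rw [Polynomial.degree_X_pow] at h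
  exact hq (by exact_mod_cast h)

/-- Over a perfect field, a polynomial all of whose exponents are divisible by the characteristic
is a `p`-th power. -/
theorem exists_pow_eq_of_forall_dvd [PerfectField k] {p : ℕ} [Fact p.Prime] [CharP k p]
    (h : ∀ m ∈ f.support, ∀ i, p ∣ m i) : ∃ g, g ^ p = f := by
  have : ExpChar k p := ExpChar.prime Fact.out
  have : PerfectRing k p := PerfectField.toPerfectRing p
  have hmem : f ∈ (frobenius (MvPolynomial (Fin n) k) p).range := by
    rw [f.as_sum]
    refine Subring.sum_mem _ fun m hm => ?_
    choose d hd using h m hm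
    obtain ⟨c, hc⟩ := surjective_frobenius k p (coeff m f)
    refine ⟨monomial (Finsupp.equivFunOnFinite.symm d) c, ?_⟩
    rw [frobenius_def, monomial_pow, ← hc, frobenius_def]
    congr 2
    ext i
    simp [hd i]
  obtain ⟨g, hg⟩ := hmem
  exact ⟨g, hg⟩

/-- If all partial derivatives vanish, every exponent of `f` is zero in `k`. Then `f` is constant in
characteristic zero, and a `p`-th power, hence composite, in characteristic `p`. -/
theorem IsNonComposite.exists_pderiv_ne_zero [PerfectField k] (hf : IsNonComposite f) :
    ∃ i, pderiv i f ≠ 0 := by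
  by_contra! h
  have key : ∀ m ∈ f.support, ∀ i, ((m i : ℕ) : k) = 0 := by
    intro m hm i
    by_cases hi : m i = 0
    · rw [hi, Nat.cast_zero]
    have h1 := congrArg (coeff (m - Finsupp.single i 1)) (h i)
    have h2 : m - Finsupp.single i 1 + Finsupp.single i 1 = m :=
      tsub_add_cancel_of_le (Finsupp.single_le_iff.2 (Nat.one_le_iff_ne_zero.2 hi))
    rw [coeff_pderiv, h2, coeff_zero, mul_eq_zero] at h1
    have h3 := h1.resolve_left (mem_support_iff.1 hm)
    rw [← Nat.cast_succ] at h3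
    convert h3
    simp
    omega
  obtain ⟨p, hp⟩ := CharP.exists k
  rcases CharP.char_is_prime_or_zero k p with hpp | rfl
  · have := Fact.mk hpp
    obtain ⟨g, hg⟩ := exists_pow_eq_of_forall_dvd (p := p) (f := f) fun m hm i =>
      (CharP.cast_eq_zero_iff k p _).1 (key m hm i)
    exact hf.pow_ne hpp.one_lt.ne' g hg
  · have := CharP.charP_to_charZero k
    obtain ⟨m, hm, hc⟩ := isNonconstant_iff.1 hf.1
    refine hm (Finsupp.ext fun i => ?_)
    exact_mod_cast key m (mem_support_iff.2 hc) i

end PthPowers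

/-! ### Purely inseparable field extensions. -/

section PurelyInseparable

/-- In exponential characteristic `q`, the polynomial `X ^ q ^ N - u` is irreducible unless `u` is
a `q`-th power. -/
theorem irreducible_X_pow_expChar_pow_sub_C {K : Type*} [Field K] (q : ℕ) [ExpChar K q] (N : ℕ)
    (u : K) (hu : q ≠ 1 → ∀ b, b ^ q ≠ u) :
    Irreducible (Polynomial.X ^ q ^ N - Polynomial.C u) := by
  by_cases hq : q = 1
  · subst hq
    rw [one_pow, pow_one]
    exact Polynomial.irreducible_X_sub_C u
  have hqN : 0 < q ^ N := expChar_pow_pos K q N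
  have : ExpChar (AlgebraicClosure K) q :=
    expChar_of_injective_algebraMap (algebraMap K (AlgebraicClosure K)).injective q
  obtain ⟨z, hz⟩ := IsAlgClosed.exists_pow_nat_eq (algebraMap K (AlgebraicClosure K) u) hqN
  -- The root `z` is purely inseparable, so its minimal polynomial is `X ^ q ^ m - y`. If `m < N`,
  -- then `u` is a power of `y` with exponent `q ^ (N - m)`, hence a `q`-th power.
  obtain ⟨m, y, hm⟩ := (minpoly.natSepDegree_eq_one_iff_eq_X_pow_sub_C q).1
    ((minpoly.natSepDegree_eq_one_iff_pow_mem q).2 ⟨N, u, hz.symm⟩)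
  have hzm : z ^ q ^ m = algebraMap K (AlgebraicClosure K) y := by
    have := minpoly.aeval K z
    rwa [hm, map_sub, map_pow, Polynomial.aeval_X, Polynomial.aeval_C, sub_eq_zero] at this
  have hirr := minpoly.irreducible (Algebra.IsIntegral.isIntegral (R := K) z)
  have hq1 : 1 < q := lt_of_le_of_ne (expChar_pos K q) (Ne.symm hq)
  have hle : m ≤ N := by
    have h1 : minpoly K z ∣ Polynomial.X ^ q ^ N - Polynomial.C u :=
      minpoly.dvd K z (by simp [hz])
    have h2 := Polynomial.natDegree_le_of_dvd h1 (Polynomial.X_pow_sub_C_ne_zero hqN u)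
    rw [hm, Polynomial.natDegree_X_pow_sub_C, Polynomial.natDegree_X_pow_sub_C] at h2
    exact (Nat.pow_le_pow_iff_right hq1).1 h2
  rcases hle.eq_or_lt with rfl | hlt
  · have : y = u := (algebraMap K (AlgebraicClosure K)).injective (by rw [← hzm, hz])
    rwa [← this, ← hm]
  · exfalso
    refine hu hq (y ^ q ^ (N - m - 1)) ((algebraMap K (AlgebraicClosure K)).injective ?_)
    rw [← hz, map_pow, map_pow, ← hzm, ← pow_mul, ← pow_mul, ← pow_succ, ← pow_add]
    congr 2
    omega

/-- Elements of an algebraic closure of `E` which are fixed by all automorphisms over `E` are purely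
inseparable over `E`. -/
theorem mem_perfectClosure_of_fixed {E Ω : Type*} [Field E] [Field Ω] [Algebra E Ω]
    [IsAlgClosure E Ω] (c : Ω) (h : ∀ σ : Ω ≃ₐ[E] Ω, σ c = c) : c ∈ perfectClosure E Ω := by
  have : IsAlgClosed Ω := IsAlgClosure.isAlgClosed E
  have : Algebra.IsAlgebraic E Ω := IsAlgClosure.isAlgebraic
  have : Algebra.IsAlgebraic (perfectClosure E Ω) Ω :=
    Algebra.IsAlgebraic.tower_top (K := E) (perfectClosure E Ω)
  have : IsAlgClosure (perfectClosure E Ω) Ω := ⟨inferInstance, inferInstance⟩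
  have : Normal (perfectClosure E Ω) Ω := IsAlgClosure.normal _ _
  -- Above the perfect closure the extension is Galois, and its automorphisms are among those over
  -- `E`.
  have : IsGalois (perfectClosure E Ω) Ω := ⟨⟩
  obtain ⟨x, rfl⟩ := (InfiniteGalois.mem_range_algebraMap_iff_fixed (k := perfectClosure E Ω) c).2
    fun σ => h (σ.restrictScalars E)
  exact x.2

end PurelyInseparable

/-! ### Irreducibility of `f - T ^ q ^ N` over `k(T)`. -/

section GenericFibre

variable {k : Type*} [Field k] {n : ℕ} {f : MvPolynomial (Fin n) k}

/-- Read as a monic polynomial in `T`, it can be tested over the fraction field of `k[x₁, …, xₙ]` by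
Gauss's lemma. There `f` is still no `q`-th power, because the polynomial ring is normal. The
isomorphism `e` exchanges the roles of `T` and the `x_i`. -/
theorem irreducible_C_X_pow_sub_map (q : ℕ) [ExpChar k q] (N : ℕ)
    (hf : q ≠ 1 → ∀ g, g ^ q ≠ f) :
    Irreducible (C (Polynomial.X ^ q ^ N) - map Polynomial.C f :
      MvPolynomial (Fin n) (Polynomial k)) := by
  let E := FractionRing (MvPolynomial (Fin n) k)
  have : ExpChar (MvPolynomial (Fin n) k) q :=
    expChar_of_injective_ringHom (C_injective (Fin n) k) q
  have : ExpChar E q := expChar_of_injective_algebraMap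
    (IsFractionRing.injective (MvPolynomial (Fin n) k) E) q
  have h1 : Irreducible (Polynomial.X ^ q ^ N -
      Polynomial.C (algebraMap (MvPolynomial (Fin n) k) E f)) := by
    refine irreducible_X_pow_expChar_pow_sub_C q N _ fun hq b hb => ?_
    obtain ⟨g, rfl⟩ := IsIntegrallyClosed.exists_algebraMap_eq_of_isIntegral_pow
      (R := MvPolynomial (Fin n) k) (expChar_pos k q)
      (hb ▸ isIntegral_algebraMap : IsIntegral (MvPolynomial (Fin n) k) (b ^ q))
    refine hf hq g (IsFractionRing.injective (MvPolynomial (Fin n) k) E ?_)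
    rw [map_pow, hb]
  have h2 : Irreducible (Polynomial.X ^ q ^ N - Polynomial.C f) := by
    rw [(Polynomial.monic_X_pow_sub_C f (expChar_pow_pos k q N).ne').irreducible_iff_irreducible_map_fraction_map
      (K := E)]
    simpa using h1
  let e : Polynomial (MvPolynomial (Fin n) k) ≃ₐ[k] MvPolynomial (Fin n) (Polynomial k) :=
    (optionEquivLeft k (Fin n)).symm.trans (optionEquivRight k (Fin n))
  have hX : e Polynomial.X = C Polynomial.X := by
    have : (optionEquivLeft k (Fin n)).symm Polynomial.X = X none := by
      rw [AlgEquiv.symm_apply_eq, optionEquivLeft_X_none]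
    simp only [e, AlgEquiv.trans_apply, this, optionEquivRight_X_none]
  have hC : ∀ g, e (Polynomial.C g) = map Polynomial.C g := by
    intro g
    have : e.toAlgHom.comp (IsScalarTower.toAlgHom k (MvPolynomial (Fin n) k) _) =
        mapAlgHom (Algebra.ofId k (Polynomial k)) := by
      apply algHom_ext
      intro i
      have : (optionEquivLeft k (Fin n)).symm (Polynomial.C (X i)) = X (some i) := by
        rw [AlgEquiv.symm_apply_eq, optionEquivLeft_X_some]
      simp [e, this]
    exact DFunLike.congr_fun this g
  have h3 := (MulEquiv.irreducible_iff e).2 h2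
  rwa [map_sub, map_pow, hX, hC, ← map_pow] at h3

theorem totalDegree_map_of_injective {R S σ : Type*} [CommSemiring R] [CommSemiring S]
    {φ : R →+* S} (hφ : Function.Injective φ) (g : MvPolynomial σ R) :
    (map φ g).totalDegree = g.totalDegree := by
  rw [totalDegree, totalDegree, support_map_of_injective g hφ]

theorem isUnit_of_isUnit_map {K L σ : Type*} [Field K] [Field L] (φ : K →+* L)
    {g : MvPolynomial σ K} (hg : IsUnit (map φ g)) : IsUnit g := by
  rw [isUnit_iff_totalDegree_of_isReduced] at hg ⊢
  rw [coeff_map, totalDegree_map_of_injective φ.injective] at hg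
  refine ⟨?_, hg.2⟩
  rw [isUnit_iff_ne_zero] at hg ⊢
  intro h
  exact hg.1 (by rw [h, map_zero])

/-- A nonconstant irreducible polynomial stays irreducible when denominators in the coefficient
domain are inverted. -/
theorem irreducible_map_fraction {A K σ : Type*} [CommRing A] [IsDomain A] [UniqueFactorizationMonoid A]
    [Field K] [Algebra A K] [IsFractionRing A K] {g : MvPolynomial σ A} (hg : Irreducible g)
    (hd : g.totalDegree ≠ 0) : Irreducible (map (algebraMap A K) g) := by
  let := algebraMvPolynomial (R := A) (S := K) (σ := σ)
  let M := (nonZeroDivisors A).map (C (σ := σ))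
  have : IsLocalization M (MvPolynomial σ K) := isLocalization _ K
  have hp : (Ideal.span {g}).IsPrime := (Ideal.span_singleton_prime hg.ne_zero).2 hg.prime
  -- A nonzero constant is not a multiple of `g`, which has positive degree; so the prime ideal of
  -- `g` survives the localization.
  have h1 := IsLocalization.isPrime_of_isPrime_disjoint M (MvPolynomial σ K) _ hp (by
    rw [Set.disjoint_left]
    rintro _ ⟨a, ha, rfl⟩ hmem
    obtain ⟨b, hb⟩ := Ideal.mem_span_singleton.1 hmem
    have ha0 : (C a : MvPolynomial σ A) ≠ 0 := by
      rw [Ne, C_eq_zero]; exact nonZeroDivisors.ne_zero ha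
    have hb0 : b ≠ 0 := by
      rintro rfl
      exact ha0 (by rw [hb, mul_zero])
    have h2 := congrArg totalDegree hb
    rw [totalDegree_mul_of_isDomain hg.ne_zero hb0, totalDegree_C] at h2
    omega)
  rw [Ideal.map_span, Set.image_singleton, Ideal.span_singleton_prime] at h1
  · exact h1.irreducible
  · intro h0
    exact hg.ne_zero (map_injective _ (IsFractionRing.injective A K) (h0.trans (map_zero _).symm))

/-- For `f` which is not a `q`-th power, `f - T ^ q ^ N` is irreducible over the field `k(T)`. -/
theorem irreducible_map_sub_X_pow (hf : IsNonconstant f) (q : ℕ) [ExpChar k q] (N : ℕ)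
    (hfq : q ≠ 1 → ∀ g, g ^ q ≠ f) (F : Type*) [Field F] [Algebra (Polynomial k) F]
    [IsFractionRing (Polynomial k) F] :
    Irreducible (map ((algebraMap (Polynomial k) F).comp Polynomial.C) f -
      C (algebraMap (Polynomial k) F Polynomial.X ^ q ^ N)) := by
  have h1 := irreducible_C_X_pow_sub_map q N hfq
  have h2 := irreducible_map_fraction (K := F) ((Associated.refl _).neg_right.irreducible h1) ?_
  · rw [neg_sub, map_sub, map_map, map_C, map_pow] at h2
    exact h2
  · rw [neg_sub]
    obtain ⟨m, hm, hc⟩ := isNonconstant_iff.1 hf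
    intro h0
    have h3 := totalDegree_eq_zero_iff_eq_C.1 h0
    have h4 := congrArg (coeff m) h3
    rw [coeff_sub, coeff_C, coeff_C, if_neg hm.symm, if_neg hm.symm, coeff_map, sub_zero,
      Polynomial.C_eq_zero] at h4
    exact hc h4

end GenericFibre

end ClosedPoly

namespace ClosedPoly

/-! ### Absolute irreducibility of the generic fibre. -/

section GenericIrreducible

variable {k : Type*} [Field k] {n : ℕ} {f : MvPolynomial (Fin n) k}

/-- For a closed polynomial `f`, the field `k(f)` is algebraically closed in `k(x₁, …, xₙ)`. -/
theorem IsClosedPoly.mem_range_of_isAlgebraic (hf : IsClosedPoly f) {E F : Type*} [Field E]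
    [Field F] [Algebra (MvPolynomial (Fin n) k) E] [IsFractionRing (MvPolynomial (Fin n) k) E]
    [Algebra (Polynomial k) F] [IsFractionRing (Polynomial k) F] [Algebra F E]
    (hFE : ∀ p : Polynomial k, algebraMap F E (algebraMap (Polynomial k) F p) =
      algebraMap (MvPolynomial (Fin n) k) E (Polynomial.aeval f p))
    {e : E} (he : IsAlgebraic F e) : e ∈ (algebraMap F E).range := by
  let _ : Algebra (Polynomial k) E :=
    ((algebraMap F E).comp (algebraMap (Polynomial k) F)).toAlgebra
  have : IsScalarTower (Polynomial k) F E := .of_algebraMap_eq fun _ => rfl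
  have hkE : ∀ p, algebraMap (Polynomial k) E p = algebraMap F E (algebraMap _ F p) := fun _ => rfl
  have hinj := IsFractionRing.injective (MvPolynomial (Fin n) k) E
  obtain ⟨c, hc0, hc⟩ := ((IsFractionRing.isAlgebraic_iff (Polynomial k) F E).2
    he).exists_integral_multiple
  rw [Algebra.smul_def] at hc
  -- The multiple of `e` by the denominator `c` is integral over `k[T]`: normality puts it into the
  -- polynomial ring, closedness of `f` into `k[f]`.
  obtain ⟨r, hr⟩ := IsIntegrallyClosed.algebraMap_eq_of_integral (R := MvPolynomial (Fin n) k)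
    (hc.map_of_comp_eq (Polynomial.aeval f).toRingHom (RingHom.id E)
      (RingHom.ext fun p => (hFE p).symm))
  rw [RingHom.id_apply] at hr
  obtain ⟨P, hPm, hP⟩ := hc
  have hri : IsIntegral (Algebra.adjoin k {f}) r := by
    let φ : Polynomial k →+* Algebra.adjoin k {f} :=
      (Polynomial.aeval (⟨f, Algebra.self_mem_adjoin_singleton k f⟩ :
        Algebra.adjoin k {f})).toRingHom
    refine ⟨P.map φ, hPm.map φ, hinj ?_⟩
    rw [Polynomial.eval₂_map, Polynomial.hom_eval₂, map_zero, hr, ← hP]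
    congr 1
    refine Polynomial.ringHom_ext (fun x => ?_) ?_
    · simpa [φ, algebraMap_eq, hkE] using (hFE (Polynomial.C x)).symm
    · simpa [φ, hkE] using (hFE Polynomial.X).symm
  obtain ⟨G, rfl⟩ := mem_adjoin_singleton_iff.1 (hf.mem_adjoin hri)
  have hc1 : algebraMap (Polynomial k) F c ≠ 0 := fun h =>
    hc0 (IsFractionRing.injective (Polynomial k) F (by rw [h, map_zero]))
  refine ⟨algebraMap _ F G / algebraMap _ F c, ?_⟩
  rw [map_div₀, hFE G, hr, div_eq_iff ((map_ne_zero _).2 hc1), mul_comm]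
  rfl

/-- If each coefficient of `g` has a `q`-power power in `A`, then one exponent serves for all. -/
theorem exists_forall_pow_mem {σ A B : Type*} [Field A] [Field B] [Algebra A B] (q : ℕ)
    (g : MvPolynomial σ B)
    (h : ∀ m, ∃ N, coeff m g ^ q ^ N ∈ (algebraMap A B).range) :
    ∃ N, ∀ N', N ≤ N' → ∀ m, coeff m g ^ q ^ N' ∈ (algebraMap A B).range := by
  classical
  choose N hN using h
  refine ⟨g.support.sup N, fun N' hN' m => ?_⟩
  by_cases hm : m ∈ g.support
  · have h1 : N m ≤ N' := (Finset.le_sup hm).trans hN'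
    obtain ⟨d, rfl⟩ := Nat.exists_eq_add_of_le h1
    rw [pow_add, pow_mul]
    exact Subring.pow_mem _ (hN m) _
  · rw [notMem_support_iff.1 hm]
    by_cases h0 : q ^ N' = 0
    · rw [h0, pow_zero]
      exact Subring.one_mem _
    · rw [zero_pow h0]
      exact Subring.zero_mem _

theorem exists_prime_dvd_of_map_eq_zero {R S : Type*} [CommRing R] [IsDomain R]
    [UniqueFactorizationMonoid R] [CommRing S] [IsDomain S] (e : R →+* S) {a : R} (ha : a ≠ 0)
    (h : e a = 0) : ∃ g, Prime g ∧ g ∣ a ∧ e g = 0 := by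
  obtain ⟨s, hs, hsa⟩ := UniqueFactorizationMonoid.exists_prime_factors a ha
  have h1 : e s.prod = 0 := by
    obtain ⟨u, hu⟩ := hsa.symm
    rw [← hu, map_mul, h, zero_mul]
  rw [map_multiset_prod, Multiset.prod_eq_zero_iff, Multiset.mem_map] at h1
  obtain ⟨g, hg, hg0⟩ := h1
  exact ⟨g, hs g hg, (Multiset.dvd_prod hg).trans hsa.dvd, hg0⟩

/-- A prime `g` all of whose conjugates vanish at a point where the cofactor `h` does not is fixed
by conjugation, provided that one of its coefficients is `1`. -/
theorem map_eq_of_prime_of_eval {K S σ : Type*} [Field K] [CommRing S] [IsDomain S] (s : K ≃+* K)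
    (e : MvPolynomial σ K →+* S) {g h : MvPolynomial σ K} (hg : Prime g) {m : σ →₀ ℕ}
    (hm : coeff m g = 1) (hfix : map (s : K →+* K) (g * h) = g * h)
    (heg : e (map (s : K →+* K) g) = 0) (heh : e h ≠ 0) :
    map (s : K →+* K) g = g ∧ map (s : K →+* K) h = h := by
  have hp : Prime (map (s : K →+* K) g) := (MulEquiv.prime_iff (mapEquiv σ s)).2 hg
  have hdvd : map (s : K →+* K) g ∣ g * h := by
    rw [← hfix, map_mul]
    exact dvd_mul_right _ _
  have h1 : map (s : K →+* K) g = g := by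
    -- The conjugate of `g` cannot divide `h`, by evaluation under `e`. So it is associated to `g`,
    -- and the coefficient `1` forces the unit to be `1`.
    rcases hp.dvd_or_dvd hdvd with h1 | ⟨r, h1⟩
    · obtain ⟨u, hu⟩ := (hp.dvd_prime_iff_associated hg).1 h1
      obtain ⟨a, ha, hau⟩ := isUnit_iff_eq_C_of_isReduced.1 u.isUnit
      rw [hau] at hu
      have h2 := congrArg (coeff m) hu
      rw [mul_comm, coeff_C_mul, coeff_map, hm, RingHom.coe_coe, map_one, mul_one] at h2
      rwa [h2, C_1, mul_one] at hu
    · refine absurd ?_ heh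
      rw [h1, map_mul, heg, zero_mul]
  refine ⟨h1, mul_left_cancel₀ hg.ne_zero ?_⟩
  rw [map_mul, h1] at hfix
  exact hfix

/-- The generic fibre `f - T` of a non-composite polynomial `f` over a perfect field `k` is
irreducible over the algebraic closure of `k(T)`. -/
theorem IsNonComposite.irreducible_generic [PerfectField k] (hf : IsNonComposite f)
    {E F Ω : Type*} [Field E] [Field F] [Field Ω]
    [Algebra (MvPolynomial (Fin n) k) E] [IsFractionRing (MvPolynomial (Fin n) k) E]
    [Algebra (Polynomial k) F] [IsFractionRing (Polynomial k) F] [Algebra F E]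
    [Algebra E Ω] [Algebra F Ω] [IsScalarTower F E Ω] [IsAlgClosure E Ω]
    (hFE : ∀ p : Polynomial k, algebraMap F E (algebraMap (Polynomial k) F p) =
      algebraMap (MvPolynomial (Fin n) k) E (Polynomial.aeval f p))
    (ι : Polynomial k →+* algebraicClosure F Ω)
    (hι : ι = (algebraMap F (algebraicClosure F Ω)).comp (algebraMap (Polynomial k) F)) :
    Irreducible (map (ι.comp Polynomial.C) f - C (ι Polynomial.X)) := by
  have hRE := IsFractionRing.injective (MvPolynomial (Fin n) k) E
  let j : algebraicClosure F Ω →+* Ω := algebraMap _ Ω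
  have hjF : ∀ x, j (algebraMap F _ x) = algebraMap E Ω (algebraMap F E x) := fun x => by
    rw [← IsScalarTower.algebraMap_apply F E Ω]
    rfl
  have hjι : ∀ p, j (ι p) = algebraMap E Ω (algebraMap _ E (Polynomial.aeval f p)) := fun p => by
    rw [hι, RingHom.comp_apply, hjF, hFE]
  -- The generic point: each `x_i` goes to itself and `T` goes to `f`, so `Φ` vanishes there.
  let y : Fin n → Ω := fun i => algebraMap E Ω (algebraMap (MvPolynomial (Fin n) k) E (X i))
  let e : MvPolynomial (Fin n) (algebraicClosure F Ω) →+* Ω := eval₂Hom j y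
  have he : ∀ g, e (map (ι.comp Polynomial.C) g) = algebraMap E Ω (algebraMap _ E g) := by
    intro g
    have : e.comp (map (ι.comp Polynomial.C)) =
        (algebraMap E Ω).comp (algebraMap (MvPolynomial (Fin n) k) E) := by
      refine ringHom_ext (fun x => ?_) fun i => ?_
      · simp [e, hjι, algebraMap_eq]
      · simp [e, y]
    exact DFunLike.congr_fun this g
  set Φ := map (ι.comp Polynomial.C) f - C (ι Polynomial.X) with hΦ
  have heΦ : e Φ = 0 := by
    rw [hΦ, map_sub, he, coe_eval₂Hom, eval₂_C, hjι, Polynomial.aeval_X, sub_self]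
  have hΦ0 : Φ ≠ 0 := by
    obtain ⟨m, hm, hc⟩ := isNonconstant_iff.1 hf.1
    intro h0
    have h1 := congrArg (coeff m) h0
    rw [hΦ, coeff_sub, coeff_C, if_neg hm.symm, sub_zero, coeff_map, coeff_zero] at h1
    exact hc ((map_eq_zero _).1 h1)
  -- an irreducible factor through the generic point, normalized
  obtain ⟨g, h, m, hg, hgm, hgh, heg⟩ : ∃ g h m, Prime g ∧ coeff m g = 1 ∧ Φ = g * h ∧ e g = 0 := by
    obtain ⟨g, hg, ⟨h, hgh⟩, heg⟩ := exists_prime_dvd_of_map_eq_zero e hΦ0 heΦ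
    obtain ⟨m, hm⟩ := ne_zero_iff.1 hg.ne_zero
    have hu : IsUnit (C (coeff m g)⁻¹ : MvPolynomial (Fin n) (algebraicClosure F Ω)) :=
      (isUnit_iff_ne_zero.2 (inv_ne_zero hm)).map C
    refine ⟨C (coeff m g)⁻¹ * g, C (coeff m g) * h, m, ?_, ?_, ?_, ?_⟩
    · exact (associated_unit_mul_left g _ hu).symm.prime hg
    · rw [coeff_C_mul, inv_mul_cancel₀ hm]
    · have : (C (coeff m g)⁻¹ * C (coeff m g) :
          MvPolynomial (Fin n) (algebraicClosure F Ω)) = 1 := by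
        rw [← C_mul, inv_mul_cancel₀ hm, C_1]
      rw [hgh]
      linear_combination (-g * h) * this
    · rw [map_mul, heg, mul_zero]
  -- The zero is simple: if both factors vanished there, so would all partial derivatives of `Φ`,
  -- which are those of `f`.
  have heh : e h ≠ 0 := by
    intro h0
    obtain ⟨i, hi⟩ := hf.exists_pderiv_ne_zero
    have h1 := congrArg (fun z => e (pderiv i z)) hgh
    simp only [hΦ, map_sub, pderiv_map, pderiv_C, sub_zero, he, Derivation.leibniz,
      smul_eq_mul, map_add, map_mul, h0, heg, zero_mul, add_zero] at h1
    exact hi (hRE (((map_eq_zero _).1 h1).trans (map_zero _).symm))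
  -- invariance under the automorphisms of the big field
  have hfixed : ∀ σ : Ω ≃ₐ[E] Ω, ∀ m, σ (j (coeff m g)) = j (coeff m g) ∧
      σ (j (coeff m h)) = j (coeff m h) := by
    intro σ
    let s : algebraicClosure F Ω ≃+* algebraicClosure F Ω :=
      (algebraicClosure.algEquivOfAlgEquiv (σ.restrictScalars F)).toRingEquiv
    have hs : ∀ x, j (s x) = σ (j x) := fun _ => rfl
    have hsι : ∀ p, s (ι p) = ι p := fun p => by
      apply j.injective
      rw [hs, hjι, σ.commutes]
    have hfix : map (s : algebraicClosure F Ω →+* algebraicClosure F Ω) Φ = Φ := by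
      have : (s : algebraicClosure F Ω →+* algebraicClosure F Ω).comp ι = ι :=
        RingHom.ext hsι
      rw [hΦ, map_sub, map_map, map_C, ← RingHom.comp_assoc, this, RingHom.coe_coe, hsι]
    have hes : ∀ g, e (map (s : algebraicClosure F Ω →+* algebraicClosure F Ω) g) = σ (e g) := by
      intro g
      have : e.comp (map (s : algebraicClosure F Ω →+* algebraicClosure F Ω)) =
          (σ : Ω →+* Ω).comp e := by
        refine ringHom_ext (fun x => ?_) fun i => ?_
        · simp [e, hs]
        · simp [e, y]
      exact DFunLike.congr_fun this g
    obtain ⟨h1, h2⟩ := map_eq_of_prime_of_eval s e hg hgm (hgh ▸ hfix)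
      (by rw [hes, heg, map_zero]) heh
    intro m
    constructor
    · rw [← hs]
      conv_rhs => rw [← h1, coeff_map]
      rfl
    · rw [← hs]
      conv_rhs => rw [← h2, coeff_map]
      rfl
  -- descend a Frobenius twist of the factorization to `k(T)`
  obtain ⟨q, hq⟩ := ExpChar.exists k
  have hqF : ExpChar F q :=
    expChar_of_injective_ringHom (((algebraMap (Polynomial k) F).comp Polynomial.C).injective) q
  have hqE : ExpChar E q := expChar_of_injective_algebraMap (algebraMap F E).injective q
  have hqL : ExpChar (algebraicClosure F Ω) q :=
    expChar_of_injective_algebraMap (algebraMap F _).injective q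
  -- A fixed element has some `q ^ N`-th power in `E`. This power is algebraic over `k(f)`, hence in
  -- `k(f)` because `f` is closed.
  have hmem : ∀ c : algebraicClosure F Ω, (∀ σ : Ω ≃ₐ[E] Ω, σ (j c) = j c) →
      ∃ N, c ^ q ^ N ∈ (algebraMap F (algebraicClosure F Ω)).range := by
    intro c hc
    obtain ⟨N, x, hx⟩ := (mem_perfectClosure_iff_pow_mem q).1
      (mem_perfectClosure_of_fixed (E := E) (j c) hc)
    have hxalg : IsAlgebraic F x := by
      have h1 : IsAlgebraic F (j (c ^ q ^ N)) :=
        (algebraicClosure.isAlgebraic F Ω).isAlgebraic (c ^ q ^ N) |>.algebraMap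
      rw [map_pow, ← hx] at h1
      exact (isAlgebraic_algebraMap_iff (algebraMap E Ω).injective).1 h1
    obtain ⟨z, rfl⟩ := hf.isClosedPoly.mem_range_of_isAlgebraic hFE hxalg
    refine ⟨N, z, j.injective ?_⟩
    rw [hjF, hx, map_pow]
  obtain ⟨N₁, hN₁⟩ := exists_forall_pow_mem q g
    fun m => hmem _ fun σ => (hfixed σ m).1
  obtain ⟨N₂, hN₂⟩ := exists_forall_pow_mem q h
    fun m => hmem _ fun σ => (hfixed σ m).2
  set N := max N₁ N₂
  let φ := iterateFrobenius (algebraicClosure F Ω) q N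
  have hlift : ∀ u : MvPolynomial (Fin n) (algebraicClosure F Ω),
      (∀ m, coeff m u ^ q ^ N ∈ (algebraMap F (algebraicClosure F Ω)).range) →
      ∃ v : MvPolynomial (Fin n) F, map (algebraMap F _) v = map φ u := by
    intro u hu
    refine mem_range_map_iff_coeffs_subset.2 fun c hc => ?_
    obtain ⟨m, -, rfl⟩ := mem_coeffs_iff.1 hc
    rw [coeff_map]
    exact hu m
  obtain ⟨g', hg'⟩ := hlift g (hN₁ N (le_max_left _ _))
  obtain ⟨h', hh'⟩ := hlift h (hN₂ N (le_max_right _ _))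
  -- Raising coefficients to the power `q ^ N` turns `f - T` into `f' - T ^ q ^ N`. Over a perfect
  -- field this twist can be undone, so `f'` is no `q`-th power when `q ≠ 1`.
  let f' := map (iterateFrobenius k q N) f
  have hnp : q ≠ 1 → ∀ b, b ^ q ≠ f' := by
    intro hq1 b hb
    have : PerfectRing k q := PerfectField.toPerfectRing q
    let θ := iterateFrobeniusEquiv k q N
    refine hf.pow_ne hq1 (map (θ.symm : k →+* k) b) ?_
    rw [← map_pow, hb, map_map]
    convert map_id f
    ext x
    exact θ.symm_apply_apply x
  have hf'n : IsNonconstant f' := by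
    obtain ⟨m, hm, hc⟩ := isNonconstant_iff.1 hf.1
    refine isNonconstant_iff.2 ⟨m, hm, ?_⟩
    rw [coeff_map]
    exact (map_ne_zero _).2 hc
  have hirr := irreducible_map_sub_X_pow hf'n q N hnp F
  have hprod : map ((algebraMap (Polynomial k) F).comp Polynomial.C) f' -
      C (algebraMap (Polynomial k) F Polynomial.X ^ q ^ N) = g' * h' := by
    apply map_injective _ (algebraMap F (algebraicClosure F Ω)).injective
    rw [map_mul, hg', hh', ← map_mul, ← hgh, hΦ, map_sub, map_sub, map_map, map_map, map_map,
      map_C, map_C]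
    congr 2
    · congr 1
      ext x : 1
      simp only [RingHom.comp_apply, φ, iterateFrobenius_def, hι, map_pow]
    · simp only [RingHom.comp_apply, φ, iterateFrobenius_def, hι, map_pow]
  have hunit : ∀ (u : MvPolynomial (Fin n) (algebraicClosure F Ω)) (v : MvPolynomial (Fin n) F),
      map (algebraMap F (algebraicClosure F Ω)) v = map φ u → IsUnit v → IsUnit u := by
    intro u v huv hv
    refine isUnit_of_isUnit_map φ ?_
    rw [← huv]
    exact hv.map _
  rcases hirr.isUnit_or_isUnit hprod with hu | hu
  · exact absurd (hunit g g' hg' hu) hg.not_isUnit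
  · rw [hgh]
    exact (associated_mul_unit_right g h (hunit h h' hh' hu)).irreducible hg.irreducible

end GenericIrreducible

end ClosedPoly

namespace ClosedPoly

/-! ### From the generic fibre to almost all fibres. -/

section Spreading

open scoped TensorProduct

/-- Nullstellensatz: a residue field of `A` is finite over `F`, hence embeds into `L`. -/
theorem nonempty_algHom_of_finiteType (F A L : Type*) [Field F] [CommRing A] [Nontrivial A]
    [Algebra F A] [Algebra.FiniteType F A] [Field L] [IsAlgClosed L] [Algebra F L] :
    Nonempty (A →ₐ[F] L) := by
  obtain ⟨m, hm⟩ := Ideal.exists_maximal A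
  let _ := Ideal.Quotient.field m
  have : Module.Finite F (A ⧸ m) := finite_of_finite_type_of_isJacobsonRing F (A ⧸ m)
  exact ⟨(IsAlgClosed.lift : A ⧸ m →ₐ[F] L).comp (Ideal.Quotient.mkₐ F m)⟩

/-- If a `k[T]`-algebra `B` of finite type has a point over infinitely many values of `T`, then it
has a point over the generic value of `T`, in any algebraically closed field. -/
theorem exists_ringHom_of_infinite {k K L B : Type*} [Field k] [Field K] [Field L] [IsAlgClosed L]
    [CommRing B] [Algebra (Polynomial k) B] [Algebra.FiniteType (Polynomial k) B]
    (c : k →+* K) (ι : Polynomial k →+* L) (hι : Function.Injective ι) {S : Set K}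
    (hS : S.Infinite) (h : ∀ μ ∈ S, ∃ φ : B →+* K,
      φ.comp (algebraMap (Polynomial k) B) = Polynomial.eval₂RingHom c μ) :
    ∃ φ : B →+* L, φ.comp (algebraMap (Polynomial k) B) = ι := by
  classical
  let F := FractionRing (Polynomial k)
  let M := nonZeroDivisors (Polynomial k)
  have hloc : IsLocalization (Algebra.algebraMapSubmonoid B M) (B ⊗[Polynomial k] F) := inferInstance
  -- If the generic fibre were zero, some nonzero `p ∈ k[T]` would vanish in `B`, and then at every
  -- point of the infinite set `S`.
  have hnt : Nontrivial (F ⊗[Polynomial k] B) := by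
    rw [← not_subsingleton_iff_nontrivial]
    intro hs
    have hs' : Subsingleton (B ⊗[Polynomial k] F) :=
      (Algebra.TensorProduct.comm (Polynomial k) B F).toEquiv.subsingleton
    obtain ⟨p, hp, hp0⟩ := (IsLocalization.subsingleton_iff
      (M := Algebra.algebraMapSubmonoid B M)).1 hs'
    have hp1 : p.map c ≠ 0 := (Polynomial.map_ne_zero_iff c.injective).2 (nonZeroDivisors.ne_zero hp)
    refine hS ((p.map c).roots.toFinset.finite_toSet.subset fun μ hμ => ?_)
    obtain ⟨φ, hφ⟩ := h μ hμ
    have h1 := DFunLike.congr_fun hφ p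
    rw [RingHom.comp_apply] at h1
    erw [hp0] at h1
    rw [map_zero, Polynomial.coe_eval₂RingHom, ← Polynomial.eval_map] at h1
    simpa [hp1] using h1.symm
  let _ : Algebra F L := (IsFractionRing.lift hι : F →+* L).toAlgebra
  obtain ⟨θ⟩ := nonempty_algHom_of_finiteType F (F ⊗[Polynomial k] B) L
  refine ⟨θ.toRingHom.comp Algebra.TensorProduct.includeRight.toRingHom, RingHom.ext fun p => ?_⟩
  have h1 : (Algebra.TensorProduct.includeRight : B →ₐ[Polynomial k] F ⊗[Polynomial k] B)
      (algebraMap _ B p) = algebraMap F _ (algebraMap _ F p) := by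
    rw [AlgHom.commutes, IsScalarTower.algebraMap_apply (Polynomial k) F]
  have h2 : θ (algebraMap F (F ⊗[Polynomial k] B) (algebraMap _ F p)) = ι p := by
    rw [θ.commutes]
    exact IsFractionRing.lift_algebraMap hι p
  rw [← h2]
  exact congrArg θ h1

variable {k : Type*} [Field k] {n : ℕ} {f : MvPolynomial (Fin n) k}

theorem coeff_eq_zero_of_isUnit {R σ : Type*} [CommRing R] [IsReduced R] {g : MvPolynomial σ R}
    (hg : IsUnit g) {m : σ →₀ ℕ} (hm : m ≠ 0) : coeff m g = 0 := by
  classical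
  obtain ⟨a, -, rfl⟩ := isUnit_iff_eq_C_of_isReduced.1 hg
  rw [coeff_C, if_neg hm.symm]

theorem sum_monomial_coeff_eq {R σ : Type*} [CommSemiring R] {D : Finset (σ →₀ ℕ)}
    {g : MvPolynomial σ R} (hg : g.support ⊆ D) : ∑ m : D, monomial (m : σ →₀ ℕ) (coeff m g) = g := by
  rw [Finset.sum_coe_sort D fun m => monomial m (coeff m g)]
  conv_rhs => rw [g.as_sum]
  refine (Finset.sum_subset hg fun m _ hm => ?_).symm
  rw [notMem_support_iff.1 hm, monomial_zero]

/-- If the generic fibre of `f` is irreducible, then only finitely many fibres split into factors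
with prescribed supports, each containing a prescribed nonzero exponent. -/
theorem finite_splitting_of_irreducible_generic {K L : Type*} [Field K] [Field L] [IsAlgClosed L]
    (c : k →+* K) (ι : Polynomial k →+* L) (hι : Function.Injective ι)
    (hirr : Irreducible (map (ι.comp Polynomial.C) f - C (ι Polynomial.X)))
    (D : Finset (Fin n →₀ ℕ)) {α β : Fin n →₀ ℕ} (hα : α ≠ 0) (hβ : β ≠ 0) :
    {μ : K | ∃ g h, map c f - C μ = g * h ∧ g.support ⊆ D ∧ h.support ⊆ D ∧
      coeff α g ≠ 0 ∧ coeff β h ≠ 0}.Finite := by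
  by_contra hS
  -- The quotient `P ⧸ I` parametrizes splittings: its variables are the coefficients of the two
  -- factors, together with an inverse `e` of the product of the prescribed coefficients, which
  -- keeps both factors nonconstant.
  let P := MvPolynomial (D ⊕ D ⊕ Unit) (Polynomial k)
  let G : MvPolynomial (Fin n) P := ∑ m : D, monomial (m : Fin n →₀ ℕ) (X (Sum.inl m))
  let H : MvPolynomial (Fin n) P := ∑ m : D, monomial (m : Fin n →₀ ℕ) (X (Sum.inr (Sum.inl m)))
  let e : P := X (Sum.inr (Sum.inr ()))
  let κ : Polynomial k →+* P := algebraMap _ P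
  let Δ : MvPolynomial (Fin n) P := map (κ.comp Polynomial.C) f - C (κ Polynomial.X) - G * H
  let I : Ideal P := Ideal.span (Set.range (fun m => coeff m Δ) ∪ {coeff α G * coeff β H * e - 1})
  obtain ⟨φ, hφ⟩ := exists_ringHom_of_infinite (B := P ⧸ I) c ι hι hS (by
    rintro μ ⟨g, h, hgh, hg, hh, hgα, hhβ⟩
    let χ : Polynomial k →+* K := Polynomial.eval₂RingHom c μ
    let ψ : P →+* K := eval₂Hom χ
      (Sum.elim (fun m => coeff m g) (Sum.elim (fun m => coeff m h)
        fun _ => (coeff α g * coeff β h)⁻¹))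
    have hψκ : ψ.comp κ = χ := RingHom.ext fun p => eval₂Hom_C _ _ p
    have hψG : map ψ G = g := by
      rw [← sum_monomial_coeff_eq hg, map_sum]
      refine Finset.sum_congr rfl fun m _ => ?_
      rw [map_monomial]
      congr 1
      exact eval₂Hom_X' _ _ _
    have hψH : map ψ H = h := by
      rw [← sum_monomial_coeff_eq hh, map_sum]
      refine Finset.sum_congr rfl fun m _ => ?_
      rw [map_monomial]
      congr 1
      exact eval₂Hom_X' _ _ _
    have hψe : ψ e = (coeff α g * coeff β h)⁻¹ := eval₂Hom_X' _ _ _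
    have hψΔ : map ψ Δ = 0 := by
      have h1 : ψ (κ Polynomial.X) = μ := by
        rw [← RingHom.comp_apply, hψκ]
        exact Polynomial.eval₂_X c μ
      have h2 : (ψ.comp κ).comp Polynomial.C = c := by
        rw [hψκ]
        exact RingHom.ext fun x => Polynomial.eval₂_C c μ
      rw [map_sub, map_sub, map_mul, hψG, hψH, map_map, map_C, h1, ← RingHom.comp_assoc, h2, hgh,
        sub_self]
    refine ⟨Ideal.Quotient.lift I ψ fun a ha => ?_, ?_⟩
    · have : I ≤ RingHom.ker ψ := by
        refine Ideal.span_le.2 ?_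
        rintro _ (⟨m, rfl⟩ | rfl)
        · change ψ (coeff m Δ) = 0
          rw [← coeff_map, hψΔ, coeff_zero]
        · change ψ _ = 0
          rw [map_sub, map_mul, map_mul, ← coeff_map, ← coeff_map, hψG, hψH, hψe, map_one,
            mul_inv_cancel₀ (mul_ne_zero hgα hhβ), sub_self]
      exact this ha
    · exact hψκ)
  let ψ : P →+* L := φ.comp (Ideal.Quotient.mk I)
  have hψκ : ψ.comp κ = ι := hφ
  have hψI : ∀ a ∈ I, ψ a = 0 := fun a ha => by
    rw [RingHom.comp_apply, Ideal.Quotient.eq_zero_iff_mem.2 ha, map_zero]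
  have hψΔ : map ψ Δ = 0 := by
    ext m
    rw [coeff_map, coeff_zero]
    exact hψI _ (Ideal.subset_span (Or.inl ⟨m, rfl⟩))
  have hfac : map (ι.comp Polynomial.C) f - C (ι Polynomial.X) = map ψ G * map ψ H := by
    rwa [map_sub, map_sub, map_mul, map_map, map_C, ← RingHom.comp_assoc, ← RingHom.comp_apply ψ κ,
      hψκ, sub_eq_zero] at hψΔ
  have hne : ψ (coeff α G) * ψ (coeff β H) * ψ e = 1 := by
    have := hψI _ (Ideal.subset_span (Or.inr rfl))
    rwa [map_sub, map_mul, map_mul, map_one, sub_eq_zero] at this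
  rcases hirr.isUnit_or_isUnit hfac with hu | hu
  · have := coeff_eq_zero_of_isUnit hu hα
    rw [coeff_map] at this
    simp [this] at hne
  · have := coeff_eq_zero_of_isUnit hu hβ
    rw [coeff_map] at this
    simp [this] at hne

/-- If the generic fibre of `f` is irreducible, then all but finitely many fibres are. -/
theorem finite_not_irreducible_of_irreducible_generic (hf : IsNonconstant f) {K L : Type*} [Field K]
    [Field L] [IsAlgClosed L] (c : k →+* K) (ι : Polynomial k →+* L) (hι : Function.Injective ι)
    (hirr : Irreducible (map (ι.comp Polynomial.C) f - C (ι Polynomial.X))) :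
    {μ : K | ¬ Irreducible (map c f - C μ)}.Finite := by
  set d := f.totalDegree
  -- Degrees add in a product, so this finite box contains the supports of all factors of fibres;
  -- only finitely many pairs `(α, β)` arise.
  let D : Finset (Fin n →₀ ℕ) := Finset.Iic (Finsupp.equivFunOnFinite.symm fun _ => d)
  have hfin : (⋃ αβ ∈ {αβ : D × D | (αβ.1 : Fin n →₀ ℕ) ≠ 0 ∧ (αβ.2 : Fin n →₀ ℕ) ≠ 0},
      {μ : K | ∃ g h, map c f - C μ = g * h ∧ g.support ⊆ D ∧ h.support ⊆ D ∧
        coeff (αβ.1 : Fin n →₀ ℕ) g ≠ 0 ∧ coeff (αβ.2 : Fin n →₀ ℕ) h ≠ 0}).Finite :=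
    (Set.toFinite _).biUnion fun αβ h =>
      finite_splitting_of_irreducible_generic c ι hι hirr D h.1 h.2
  refine hfin.subset fun μ hμ => ?_
  have hfd : (map c f - C μ).totalDegree ≤ d := by
    refine (totalDegree_sub_C_le _ _).trans ?_
    rw [totalDegree_map_of_injective c.injective]
  obtain ⟨m, hm, hmc⟩ := isNonconstant_iff.1 hf
  have hcm : coeff m (map c f - C μ) ≠ 0 := by
    rw [coeff_sub, coeff_C, if_neg hm.symm, sub_zero, coeff_map]
    exact (map_ne_zero c).2 hmc
  have hf0 : map c f - C μ ≠ 0 := fun h => hcm (by rw [h, coeff_zero])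
  have hnu : ¬ IsUnit (map c f - C μ) := fun h => hcm (coeff_eq_zero_of_isUnit h hm)
  rw [Set.mem_ofPred_eq, irreducible_iff] at hμ
  push Not at hμ
  obtain ⟨g, h, hgh, hg, hh⟩ := hμ hnu
  have hg0 : g ≠ 0 := by
    rintro rfl
    exact hf0 (by rw [hgh, zero_mul])
  have hh0 : h ≠ 0 := by
    rintro rfl
    exact hf0 (by rw [hgh, mul_zero])
  have hdeg : g.totalDegree + h.totalDegree ≤ d := by
    rwa [hgh, totalDegree_mul_of_isDomain hg0 hh0] at hfd
  have hsupp : ∀ u : MvPolynomial (Fin n) K, u.totalDegree ≤ d → u.support ⊆ D := by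
    intro u hu m hm
    rw [Finset.mem_Iic]
    intro i
    have h1 : m i ≤ m.degree := Finsupp.le_degree i m
    have h2 : m.degree ≤ u.totalDegree := le_totalDegree hm
    exact h1.trans (h2.trans hu)
  have hnc : ∀ u : MvPolynomial (Fin n) K, u ≠ 0 → ¬ IsUnit u → ∃ m, m ≠ 0 ∧ coeff m u ≠ 0 := by
    intro u hu0 hu
    refine isNonconstant_iff.1 ?_
    rintro ⟨a, rfl⟩
    exact hu ((isUnit_iff_ne_zero.2 fun ha => hu0 (by rw [ha, C_0])).map C)
  obtain ⟨α, hα, hαg⟩ := hnc g hg0 hg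
  obtain ⟨β, hβ, hβh⟩ := hnc h hh0 hh
  have hgD := hsupp g (by omega)
  have hhD := hsupp h (by omega)
  simp only [Set.mem_iUnion]
  exact ⟨(⟨α, hgD (mem_support_iff.2 hαg)⟩, ⟨β, hhD (mem_support_iff.2 hβh)⟩), ⟨hα, hβ⟩,
    g, h, hgh, hgD, hhD, hαg, hβh⟩

/-- Here `k(T)` is embedded in `k(x₁, …, xₙ)` by `T ↦ f`, and `L` is its algebraic closure inside
that of `k(x₁, …, xₙ)`. The negation at the end passes from `f - μ` to `f + μ`. -/
theorem IsNonComposite.finite_not_irreducible [PerfectField k] (hf : IsNonComposite f) :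
    {μ : AlgebraicClosure k | ¬ IrreducibleShift f μ}.Finite := by
  let E := FractionRing (MvPolynomial (Fin n) k)
  let Ω := AlgebraicClosure E
  let F := FractionRing (Polynomial k)
  have hinj : Function.Injective ((algebraMap (MvPolynomial (Fin n) k) E).comp
      (Polynomial.aeval f : Polynomial k →ₐ[k] MvPolynomial (Fin n) k).toRingHom) :=
    (IsFractionRing.injective (MvPolynomial (Fin n) k) E).comp hf.1.aeval_injective
  let _ : Algebra F E := (IsFractionRing.lift hinj : F →+* E).toAlgebra
  have : IsAlgClosed (algebraicClosure F Ω) := (algebraicClosure.isAlgClosure F Ω).isAlgClosed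
  have h1 := hf.irreducible_generic (E := E) (F := F) (Ω := Ω)
    (fun p => IsFractionRing.lift_algebraMap hinj p) _ rfl
  have h2 := finite_not_irreducible_of_irreducible_generic hf.1
    (algebraMap k (AlgebraicClosure k)) _
    ((algebraMap F _).injective.comp (IsFractionRing.injective (Polynomial k) F)) h1
  refine (h2.image Neg.neg).subset fun μ hμ => ⟨-μ, ?_, neg_neg μ⟩
  rw [Set.mem_ofPred_eq, map_neg, sub_neg_eq_add]
  exact hμ

theorem exists_irreducibleShift_of_finite
    (h : {μ : AlgebraicClosure k | ¬ IrreducibleShift f μ}.Finite) :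
    ∃ μ : AlgebraicClosure k, IrreducibleShift f μ := by
  by_contra! hc
  refine (Set.infinite_univ (α := AlgebraicClosure k)) (h.subset fun μ _ => hc μ)

/-- If `deg F ≥ 2` and `a` is a root of `F + μ`, then `F(g) + μ = (g - a) Q(g)` with both factors
nonconstant. -/
theorem isNonComposite_of_irreducibleShift (hf : IsNonconstant f) {μ : AlgebraicClosure k}
    (h : IrreducibleShift f μ) : IsNonComposite f := by
  refine ⟨hf, ?_⟩
  rintro F g rfl
  obtain ⟨hg, hF⟩ := hf.of_aeval
  refine (Polynomial.degree_eq_iff_natDegree_eq_of_pos one_pos).2 ?_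
  by_contra hd
  set c := algebraMap k (AlgebraicClosure k)
  set g' := map c g with hg'
  have hgn : IsNonconstant g' := by
    obtain ⟨m, hm, hc⟩ := isNonconstant_iff.1 hg
    refine isNonconstant_iff.2 ⟨m, hm, ?_⟩
    rw [coeff_map]
    exact (map_ne_zero _).2 hc
  set F' := F.map c + Polynomial.C μ with hF'
  have hF'd : F'.natDegree = F.natDegree := by
    rw [hF', Polynomial.natDegree_add_C, Polynomial.natDegree_map]
  have hmap : map c (Polynomial.aeval g F) + C μ = Polynomial.aeval g' F' := by
    rw [hF', map_add, Polynomial.aeval_C, Polynomial.aeval_def, Polynomial.aeval_def,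
      Polynomial.eval₂_map, Polynomial.hom_eval₂]
    congr 2
    ext x
    simp [algebraMap_eq]
  obtain ⟨a, ha⟩ := IsAlgClosed.exists_root F' (by
    intro h0
    rw [Polynomial.natDegree_eq_zero_iff_degree_le_zero.2 h0.le] at hF'd
    omega)
  obtain ⟨Q, hQ⟩ := Polynomial.dvd_iff_isRoot.2 ha
  have hQ0 : Q ≠ 0 := by
    rintro rfl
    rw [mul_zero] at hQ
    rw [hQ, Polynomial.natDegree_zero] at hF'd
    omega
  have hQd : Q.natDegree ≠ 0 := by
    rw [hQ, Polynomial.natDegree_mul (Polynomial.X_sub_C_ne_zero a) hQ0,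
      Polynomial.natDegree_X_sub_C] at hF'd
    omega
  have hnu : ∀ R : Polynomial (AlgebraicClosure k), R.natDegree ≠ 0 →
      ¬ IsUnit (Polynomial.aeval g' R) := by
    intro R hR hu
    obtain ⟨b, -, hb⟩ := isUnit_iff_eq_C_of_isReduced.1 hu
    have : Polynomial.aeval g' R = Polynomial.aeval g' (Polynomial.C b) := by
      rw [hb, Polynomial.aeval_C, algebraMap_eq]
    exact hR (by rw [hgn.aeval_injective this, Polynomial.natDegree_C])
  have hfac : map c (Polynomial.aeval g F) + C μ = Polynomial.aeval g' (Polynomial.X - Polynomial.C a)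
      * Polynomial.aeval g' Q := by
    rw [hmap, hQ, map_mul]
  rcases Irreducible.isUnit_or_isUnit h hfac with hu | hu
  · exact hnu _ (by rw [Polynomial.natDegree_X_sub_C]; exact one_ne_zero) hu
  · exact hnu _ hQd hu

end Spreading

end ClosedPoly

namespace ClosedPoly

/-! ### Kernels of derivations in characteristic zero. -/

section Derivations

open scoped TensorProduct KaehlerDifferential IntermediateField

/-- If all elements of `K` have differential zero in a formally smooth extension `E` of `K`, then
`K` is unramified over the base. -/
theorem formallyUnramified_of_D_algebraMap_eq_zero (F K E : Type*) [Field F] [Field K] [Field E]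
    [Algebra F K] [Algebra K E] [Algebra F E] [IsScalarTower F K E] [Algebra.FormallySmooth K E]
    (h : ∀ x : K, KaehlerDifferential.D F E (algebraMap K E x) = 0) :
    Algebra.FormallyUnramified F K := by
  -- In the Jacobi–Zariski sequence, the kernel comes from the first homology of the cotangent
  -- complex of `E` over `K`, which vanishes by formal smoothness.
  have hinj : Function.Injective (KaehlerDifferential.mapBaseChange F K E) := by
    rw [injective_iff_map_eq_zero]
    intro x hx
    obtain ⟨y, rfl⟩ := (Algebra.H1Cotangent.exact_δ_mapBaseChange F K E x).1 hx
    rw [Subsingleton.elim y 0, map_zero]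
  have hD : ∀ x : K, KaehlerDifferential.D F K x = 0 := by
    intro x
    have h1 : (1 : E) ⊗ₜ[K] KaehlerDifferential.D F K x = 0 := by
      apply hinj
      rw [KaehlerDifferential.mapBaseChange_tmul, KaehlerDifferential.map_D, map_zero, one_smul]
      exact h x
    apply Module.FaithfullyFlat.tensorProduct_mk_injective (A := K) (B := E) (Ω[K⁄F])
    simpa using h1
  have htop : (⊤ : Submodule K (Ω[K⁄F])) = ⊥ := by
    rw [← KaehlerDifferential.span_range_derivation, Submodule.span_eq_bot]
    rintro _ ⟨x, rfl⟩
    exact hD x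
  exact ⟨(Submodule.subsingleton_iff K).1 (subsingleton_of_bot_eq_top htop.symm)⟩

universe u

/-- In characteristic zero, the differential of a transcendental element is nonzero. -/
theorem kaehler_D_ne_zero_of_transcendental {F E : Type u} [Field F] [Field E] [Algebra F E]
    [CharZero F] [Algebra.EssFiniteType F E] {g : E} (hg : Transcendental F g) :
    KaehlerDifferential.D F E g ≠ 0 := by
  intro h0
  -- If `dg = 0`, all of `F(g)` has zero differential, so `F(g)` is unramified over `F`, hence
  -- algebraic.
  have hker : ∀ x ∈ F⟮g⟯, KaehlerDifferential.D F E x = 0 := by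
    intro x hx
    induction hx using IntermediateField.adjoin_induction with
    | mem x hx => rw [Set.mem_singleton_iff.1 hx, h0]
    | algebraMap x => exact Derivation.map_algebraMap _ x
    | add x y _ _ hx hy => rw [map_add, hx, hy, add_zero]
    | inv x _ hx => rw [Derivation.leibniz_inv, hx, smul_zero]
    | mul x y _ _ hx hy => rw [Derivation.leibniz, hx, hy, smul_zero, smul_zero, add_zero]
  have : Algebra.EssFiniteType F⟮g⟯ E := Algebra.EssFiniteType.of_comp F F⟮g⟯ E
  have : CharZero F⟮g⟯ := charZero_of_injective_algebraMap (algebraMap F F⟮g⟯).injective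
  have := formallyUnramified_of_D_algebraMap_eq_zero F F⟮g⟯ E fun x => hker x x.2
  have : Algebra.EssFiniteType F F⟮g⟯ :=
    IntermediateField.essFiniteType_iff.2 (IntermediateField.fg_adjoin_of_finite
      (Set.finite_singleton g))
  have : Algebra.IsSeparable F F⟮g⟯ := Algebra.FormallyUnramified.isSeparable F F⟮g⟯
  refine hg ?_
  have h2 : IsAlgebraic F (⟨g, IntermediateField.mem_adjoin_simple_self F g⟩ : F⟮g⟯) :=
    Algebra.IsAlgebraic.isAlgebraic _
  exact h2.algebraMap (A := E)

/-- From `p(x) = 0` follows `p'(x) * D x = 0`. If `p'(x) = 0`, induction applies to `p'`, which is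
nonzero in characteristic zero. -/
theorem map_eq_zero_of_isAlgebraic {R A : Type*} [CommRing R] [CommRing A] [IsDomain R]
    [CharZero R] [IsDomain A] [Algebra R A] [FaithfulSMul R A] (D : Derivation R A A) {x : A}
    (hx : IsAlgebraic R x) : D x = 0 := by
  obtain ⟨p, hp0, hp⟩ := hx
  induction hd : p.natDegree using Nat.strong_induction_on generalizing p with
  | _ d ih =>
    have hd0 : p.natDegree ≠ 0 := by
      intro h
      rw [Polynomial.eq_C_of_natDegree_eq_zero h] at hp hp0
      rw [Polynomial.aeval_C] at hp
      refine hp0 ?_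
      rw [(FaithfulSMul.algebraMap_injective R A) (hp.trans (map_zero _).symm), Polynomial.C_0]
    have h1 : Polynomial.aeval x p.derivative * D x = 0 := by
      rw [← smul_eq_mul, ← Derivation.map_aeval, hp, map_zero]
    rcases mul_eq_zero.1 h1 with h1 | h1
    · refine ih _ (hd ▸ Polynomial.natDegree_derivative_lt hd0) p.derivative (fun h => hd0 ?_) h1 rfl
      exact Polynomial.derivative_eq_zero.1 h
    · exact h1

variable {k : Type*} [Field k] {n : ℕ} {f : MvPolynomial (Fin n) k}

/-- Each `D ∈ S` kills `k[f]`, so it is `k[f]`-linear and kills every element integral over `k[f]`.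
-/
theorem IsKernelIntersection.isClosedPoly [CharZero k] (hf : IsNonconstant f)
    {S : Set (Derivation k (MvPolynomial (Fin n) k) (MvPolynomial (Fin n) k))}
    (hS : IsKernelIntersection f S) : IsClosedPoly f := by
  refine ⟨hf, isIntegrallyClosedIn_iff.2 ⟨Subtype.val_injective, fun {x} hx => ?_⟩⟩
  suffices hxm : x ∈ Algebra.adjoin k {f} from ⟨⟨x, hxm⟩, rfl⟩
  have hmem : ∀ y, y ∈ Algebra.adjoin k {f} ↔ ∀ D ∈ S, D y = 0 := fun y => by
    rw [← SetLike.mem_coe, hS]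
    simp
  rw [hmem]
  intro D hD
  let D' : Derivation (Algebra.adjoin k {f}) (MvPolynomial (Fin n) k) (MvPolynomial (Fin n) k) :=
    Derivation.mk'
      { toFun := D
        map_add' := map_add D
        map_smul' := fun a y => by
          have ha : D a = 0 := (hmem a).1 a.2 D hD
          rw [Algebra.smul_def, Algebra.smul_def, Derivation.leibniz]
          simp [ha] }
      (fun a b => D.leibniz a b)
  have : CharZero (Algebra.adjoin k {f}) :=
    charZero_of_injective_algebraMap (algebraMap k (Algebra.adjoin k {f})).injective
  have : FaithfulSMul (Algebra.adjoin k {f}) (MvPolynomial (Fin n) k) :=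
    (faithfulSMul_iff_algebraMap_injective _ _).2 Subtype.val_injective
  exact map_eq_zero_of_isAlgebraic D' hx.isAlgebraic

theorem derivation_eq_sum (D : Derivation k (MvPolynomial (Fin n) k) (MvPolynomial (Fin n) k))
    (g : MvPolynomial (Fin n) k) : D g = ∑ i, D (X i) * pderiv i g := by
  have hsum : ∀ h, (∑ i, D (X i) • pderiv i : Derivation k _ _) h = ∑ i, D (X i) * pderiv i h :=
    fun h => by
      change Derivation.coeFnAddMonoidHom _ h = _
      rw [map_sum, Finset.sum_apply]
      rfl
  have : D = ∑ i, D (X i) • pderiv i := by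
    apply derivation_ext
    intro j
    rw [hsum, Finset.sum_eq_single j]
    · simp
    · intro i _ hij
      simp [pderiv_X_of_ne hij.symm]
    · simp
  rw [← hsum, ← this]

/-- By Bézout, `b(f)` is a unit, hence a constant. This shows that a polynomial lying in `k(f)` lies
in `k[f]`. -/
theorem mem_adjoin_of_mul_aeval_eq {g : MvPolynomial (Fin n) k}
    {a b : Polynomial k} (hab : IsCoprime a b) (h : Polynomial.aeval f a = g * Polynomial.aeval f b) :
    g ∈ Algebra.adjoin k {f} := by
  obtain ⟨u, v, huv⟩ := hab
  have h1 := congrArg (Polynomial.aeval f) huv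
  rw [map_add, map_mul, map_mul, map_one, h] at h1
  have hu : IsUnit (Polynomial.aeval f b) := .of_mul_eq_one
    (Polynomial.aeval f u * g + Polynomial.aeval f v) (by rw [← h1]; ring)
  obtain ⟨c, hc, hbc⟩ := isUnit_iff_eq_C_of_isReduced.1 hu
  refine mem_adjoin_singleton_iff.2 ⟨a * Polynomial.C c⁻¹, ?_⟩
  rw [map_mul, h, hbc, Polynomial.aeval_C, algebraMap_eq, mul_assoc, ← C_mul,
    mul_inv_cancel₀ hc.ne_zero, C_1, mul_one]

/-- As `k(f)` is algebraically closed in `k(x₁, …, xₙ)`, `g` is transcendental over it and `dg ≠ 0`.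
A linear form not killing `dg` gives a `k(f)`-derivation `d` of the function field, and a common
denominator `b` of the `d(x_i)` makes `b * d` preserve polynomials. -/
theorem IsClosedPoly.exists_derivation [CharZero k] (hf : IsClosedPoly f)
    {g : MvPolynomial (Fin n) k} (hg : g ∉ Algebra.adjoin k {f}) :
    ∃ D : Derivation k (MvPolynomial (Fin n) k) (MvPolynomial (Fin n) k), D f = 0 ∧ D g ≠ 0 := by
  let E := FractionRing (MvPolynomial (Fin n) k)
  let F := FractionRing (Polynomial k)
  have hinjE := IsFractionRing.injective (MvPolynomial (Fin n) k) E
  have hinj : Function.Injective ((algebraMap (MvPolynomial (Fin n) k) E).comp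
      (Polynomial.aeval f : Polynomial k →ₐ[k] MvPolynomial (Fin n) k).toRingHom) :=
    hinjE.comp hf.1.aeval_injective
  let _ : Algebra F E := (IsFractionRing.lift hinj : F →+* E).toAlgebra
  have hFE : ∀ p : Polynomial k, algebraMap F E (algebraMap (Polynomial k) F p) =
      algebraMap (MvPolynomial (Fin n) k) E (Polynomial.aeval f p) :=
    fun p => IsFractionRing.lift_algebraMap hinj p
  have htr : Transcendental F (algebraMap (MvPolynomial (Fin n) k) E g) := by
    intro halg
    obtain ⟨z, hz⟩ := hf.mem_range_of_isAlgebraic hFE halg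
    refine hg (mem_adjoin_of_mul_aeval_eq
      (IsFractionRing.num_den_reduced (Polynomial k) z).isCoprime (hinjE ?_))
    rw [map_mul, ← hz, ← hFE, ← hFE, ← map_mul]
    congr 1
    exact ((IsLocalization.mk'_eq_iff_eq_mul).1 (IsFractionRing.mk'_num_den (Polynomial k) z))
  have : IsScalarTower k F E := .of_algebraMap_eq fun x => by
    rw [IsScalarTower.algebraMap_apply k (Polynomial k) F, hFE,
      IsScalarTower.algebraMap_apply k (MvPolynomial (Fin n) k) E, Polynomial.algebraMap_eq,
      Polynomial.aeval_C]
  have : Algebra.EssFiniteType (MvPolynomial (Fin n) k) E :=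
    Algebra.EssFiniteType.of_isLocalization _ (nonZeroDivisors (MvPolynomial (Fin n) k))
  have : Algebra.EssFiniteType k E := Algebra.EssFiniteType.comp k (MvPolynomial (Fin n) k) E
  have : Algebra.EssFiniteType F E := Algebra.EssFiniteType.of_comp k F E
  have : CharZero F := charZero_of_injective_algebraMap (algebraMap k F).injective
  have hD := kaehler_D_ne_zero_of_transcendental htr
  obtain ⟨l, hl⟩ : ∃ l : Ω[E⁄F] →ₗ[E] E,
      l (KaehlerDifferential.D F E (algebraMap (MvPolynomial (Fin n) k) E g)) ≠ 0 := by
    by_contra! hl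
    exact hD ((Module.forall_dual_apply_eq_zero_iff E _).1 hl)
  let d : Derivation F E E := l.compDer (KaehlerDifferential.D F E)
  obtain ⟨b, hb⟩ := IsLocalization.exist_integer_multiples_of_finite
    (nonZeroDivisors (MvPolynomial (Fin n) k))
    (fun i : Fin n => d (algebraMap (MvPolynomial (Fin n) k) E (X i)))
  choose r hr using hb
  let D := mkDerivation k r
  have hb0 : algebraMap (MvPolynomial (Fin n) k) E b ≠ 0 := fun h =>
    nonZeroDivisors.ne_zero b.2 (hinjE (h.trans (map_zero _).symm))
  have key : ∀ p, algebraMap (MvPolynomial (Fin n) k) E (D p) =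
      algebraMap (MvPolynomial (Fin n) k) E b * d (algebraMap _ E p) := by
    intro p
    induction p using MvPolynomial.induction_on with
    | C a =>
      have h1 : algebraMap (MvPolynomial (Fin n) k) E (C a) =
          algebraMap F E (algebraMap _ F (Polynomial.C a)) := by
        rw [hFE, Polynomial.aeval_C, algebraMap_eq]
      rw [derivation_C, map_zero, h1, d.map_algebraMap, mul_zero]
    | add p q hp hq => rw [map_add, map_add, map_add, map_add, hp, hq, mul_add]
    | mul_X p i hp =>
      have h1 : algebraMap (MvPolynomial (Fin n) k) E (D (X i)) =
          algebraMap (MvPolynomial (Fin n) k) E b * d (algebraMap (MvPolynomial (Fin n) k) E (X i)) := by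
        rw [mkDerivation_X, hr, Algebra.smul_def]
      rw [Derivation.leibniz, map_mul, Derivation.leibniz, smul_eq_mul, smul_eq_mul, smul_eq_mul,
        smul_eq_mul, map_add, map_mul, map_mul, hp, h1]
      ring
  refine ⟨D, hinjE ?_, fun h0 => ?_⟩
  · have h1 : algebraMap (MvPolynomial (Fin n) k) E f =
        algebraMap F E (algebraMap (Polynomial k) F Polynomial.X) := by
      rw [hFE, Polynomial.aeval_X]
    rw [key, h1, d.map_algebraMap, mul_zero, map_zero]
  · have h1 := key g
    rw [h0, map_zero, eq_comm, mul_eq_zero] at h1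
    exact hl (h1.resolve_left hb0)

/-- In characteristic zero, `k[f]` is cut out by the Jacobian derivations of a closed `f`. -/
theorem IsClosedPoly.exists_finite_isKernelIntersection [CharZero k] (hf : IsClosedPoly f) :
    ∃ S : Set (Derivation k (MvPolynomial (Fin n) k) (MvPolynomial (Fin n) k)),
      S.Finite ∧ IsKernelIntersection f S := by
  let J : Fin n × Fin n → Derivation k (MvPolynomial (Fin n) k) (MvPolynomial (Fin n) k) :=
    fun ij => pderiv ij.1 f • pderiv ij.2 - pderiv ij.2 f • pderiv ij.1
  have hJ : ∀ i j g, J (i, j) g = pderiv i f * pderiv j g - pderiv j f * pderiv i g :=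
    fun _ _ _ => rfl
  refine ⟨Set.range J, Set.finite_range J, Set.ext fun g => ?_⟩
  rw [Set.biInter_range, Set.mem_iInter, SetLike.mem_coe]
  constructor
  · rintro hg ⟨i, j⟩
    obtain ⟨G, rfl⟩ := mem_adjoin_singleton_iff.1 hg
    change J (i, j) _ = 0
    rw [Derivation.map_aeval, hJ, mul_comm, sub_self, smul_zero]
  · intro hg
    by_contra hgf
    obtain ⟨D, hDf, hDg⟩ := hf.exists_derivation hgf
    obtain ⟨i, hi⟩ := hf.isNonComposite.exists_pderiv_ne_zero
    refine hDg ((mul_eq_zero.1 ?_).resolve_left hi)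
    -- When all Jacobian minors of `f` and `g` vanish, their gradients are proportional, so `D f =
    -- 0` would force `D g = 0`.
    have h1 : pderiv i f * D g = pderiv i g * D f := by
      rw [derivation_eq_sum D g, derivation_eq_sum D f, Finset.mul_sum, Finset.mul_sum]
      refine Finset.sum_congr rfl fun j _ => ?_
      have h2 : J (i, j) g = 0 := hg (i, j)
      rw [hJ] at h2
      linear_combination D (X j) * h2
    rw [h1, hDf, mul_zero]

end Derivations

end ClosedPoly

theorem theorem2p3 {k : Type*} [Field k] {n : ℕ} (f : MvPolynomial (Fin n) k)
    (hf : ClosedPoly.IsNonconstant f) :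
    List.TFAE [
      ClosedPoly.IsNonComposite f,
      Maximal (· ∈ ClosedPoly.singlyGenerated k n) (Algebra.adjoin k {f}),
      ClosedPoly.IsClosedPoly f] ∧
    (PerfectField k → List.TFAE [
      ClosedPoly.IsNonComposite f,
      Maximal (· ∈ ClosedPoly.singlyGenerated k n) (Algebra.adjoin k {f}),
      ClosedPoly.IsClosedPoly f,
      {μ : AlgebraicClosure k | ¬ ClosedPoly.IrreducibleShift f μ}.Finite,
      ∃ μ : AlgebraicClosure k, ClosedPoly.IrreducibleShift f μ]) ∧
    (CharZero k → List.TFAE [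
      ClosedPoly.IsNonComposite f,
      Maximal (· ∈ ClosedPoly.singlyGenerated k n) (Algebra.adjoin k {f}),
      ClosedPoly.IsClosedPoly f,
      {μ : AlgebraicClosure k | ¬ ClosedPoly.IrreducibleShift f μ}.Finite,
      ∃ μ : AlgebraicClosure k, ClosedPoly.IrreducibleShift f μ,
      ∃ S : Set (Derivation k (MvPolynomial (Fin n) k) (MvPolynomial (Fin n) k)),
        S.Finite ∧ ClosedPoly.IsKernelIntersection f S,
      ∃ S : Set (Derivation k (MvPolynomial (Fin n) k) (MvPolynomial (Fin n) k)),
        ClosedPoly.IsKernelIntersection f S]) := by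
  have h12 := ClosedPoly.isNonComposite_iff_maximal hf
  have h13 := ClosedPoly.isNonComposite_iff_isClosedPoly (f := f)
  have h51 : (∃ μ : AlgebraicClosure k, ClosedPoly.IrreducibleShift f μ) →
      ClosedPoly.IsNonComposite f :=
    fun ⟨_, hμ⟩ => ClosedPoly.isNonComposite_of_irreducibleShift hf hμ
  have h45 := ClosedPoly.exists_irreducibleShift_of_finite (f := f)
  refine ⟨?_, fun _ => ?_, fun _ => ?_⟩
  · tfae_have 1 ↔ 2 := h12
    tfae_have 1 ↔ 3 := h13
    tfae_finish
  · tfae_have 1 ↔ 2 := h12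
    tfae_have 1 ↔ 3 := h13
    tfae_have 1 → 4 := fun h => h.finite_not_irreducible
    tfae_have 4 → 5 := h45
    tfae_have 5 → 1 := h51
    tfae_finish
  · tfae_have 1 ↔ 2 := h12
    tfae_have 1 ↔ 3 := h13
    tfae_have 1 → 4 := fun h => h.finite_not_irreducible
    tfae_have 4 → 5 := h45
    tfae_have 5 → 1 := h51
    tfae_have 3 → 6 := fun h => h.exists_finite_isKernelIntersection
    tfae_have 6 → 7 := fun ⟨S, _, hS⟩ => ⟨S, hS⟩
    tfae_have 7 → 3 := fun ⟨_, hS⟩ => hS.isClosedPoly hf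
    tfae_finish
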